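/- For complex $\nu$ and $z$ let $$D_\nu(z)=2^{\nu/2}e^{-z^2/4}\left[\frac{\Gamma(1/2)}{\Gamma((1-\nu)/2)}\,\Phi\!\left(-\tfrac{\nu}{2};\tfrac12;\tfrac{z^2}{2}\right)+\frac{z}{\sqrt2}\,\frac{\Gamma(-1/2)}{\Gamma(-\nu/2)}\,\Phi\!\left(\tfrac{1-\nu}{2};\tfrac32;\tfrac{z^2}{2}\right)\right]$$ be the parabolic cylinder function, where $\Phi(a;b;z)=\sum_{n\ge0}\frac{(a)_n}{(b)_n}\frac{z^n}{n!}$ is Kummer's confluent hypergeometric function and $1/\Gamma$ is read as $0$ at the poles of $\Gamma$. For $-1<s<1$ let $$P_b^{a}(s)=\left(\frac{1+s}{1-s}\right)^{a/2}\frac{1}{\Gamma(1-a)}\,F\!\left(-b,b+1;1-a;\tfrac{1-s}{2}\right)$$ be the associated Legendre function of the first kind on the cut (Ferrers function) of degree $b$ and order $a$, where $F/\Gamma$ denotes the regularized Gaussian hypergeometric function $\frac{1}{\Gamma(c)}F(\alpha,\beta;c;w)=\sum_{n\ge0}\frac{(\alpha)_n(\beta)_n}{\Gamma(c+n)}\frac{w^n}{n!}$.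 Let $\nu,\mu\in\mathbb C$ with $\operatorname{Re}\nu<0$ and $\operatorname{Re}\mu<1$, and let $x\ge0$, $y\ge0$ be real. Then $$D_\nu(x)D_\mu(y)=e^{-\frac14(x^2+y^2)}\int_0^\infty e^{-t}(2t)^{-\frac{1+\nu+\mu}{4}}(x^2+2t)^{\frac{\nu-\mu-1}{4}}(y^2+2t)^{\frac{\mu-\nu-1}{4}}(x^2+y^2+2t)^{\frac{1+\nu+\mu}{4}}\,P_{(\mu-\nu-1)/2}^{(1+\nu+\mu)/2}\!\left(\frac{xy}{\sqrt{(x^2+2t)(y^2+2t)}}\right)dt,$$ where the integral converges absolutely. -/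

import Mathlib

/-- Kummer's confluent hypergeometric function `Φ(a; b; z) = ∑ (a)ₙ / (b)ₙ · zⁿ / n!`
(for `b` not a nonpositive integer). Mathlib's regularized series has the coefficients
`(a)ₙ / (Γ(b + n) n!)`. -/
noncomputable def kummerPhi (a b z : ℂ) : ℂ :=
  Complex.Gamma b * Complex.regularizedHGFun {a} {b} z

/-- The parabolic cylinder function `D_ν(z)`, defined through Kummer's function. Mathlib's
`Complex.Gamma` vanishes at the poles of `Γ`, so division by it is multiplication by the
entire function `1 / Γ`. -/
noncomputable def parabolicCylinderD (ν z : ℂ) : ℂ :=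
  (2 : ℂ) ^ (ν / 2) * Complex.exp (-(z ^ 2) / 4) *
    (Complex.Gamma (1 / 2) / Complex.Gamma ((1 - ν) / 2) *
        kummerPhi (-ν / 2) (1 / 2) (z ^ 2 / 2) +
      z / ((Real.sqrt 2 : ℝ) : ℂ) * (Complex.Gamma (-1 / 2) / Complex.Gamma (-ν / 2)) *
        kummerPhi ((1 - ν) / 2) (3 / 2) (z ^ 2 / 2))

/-- The associated Legendre function of the first kind `P_ν^μ(x)` of degree `ν` and order `μ` on
the cut `-1 < x < 1` (the Ferrers function):
`P_ν^μ(x) = ((1 + x) / (1 - x)) ^ (μ / 2) · F(-ν, ν + 1; 1 - μ; (1 - x) / 2) / Γ(1 - μ)`,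
where `F / Γ` is Mathlib's regularized Gaussian hypergeometric function. -/
noncomputable def legendreP (ν μ : ℂ) (x : ℝ) : ℂ :=
  (((1 + x) / (1 - x) : ℝ) : ℂ) ^ (μ / 2) *
    Complex.regularizedGaussHGFun (-ν) (ν + 1) (1 - μ) (((1 - x) / 2 : ℝ) : ℂ)

/-- The integrand, as a function of `t > 0`, of the Legendre function representation of
`exp ((x² + y²) / 4) D_ν(x) D_μ(y)`. -/
noncomputable def productIntegrand (ν μ : ℂ) (x y t : ℝ) : ℂ :=
  Complex.exp (-(t : ℂ)) * ((2 * t : ℝ) : ℂ) ^ (-(1 + ν + μ) / 4) *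
    ((x ^ 2 + 2 * t : ℝ) : ℂ) ^ ((ν - μ - 1) / 4) *
    ((y ^ 2 + 2 * t : ℝ) : ℂ) ^ ((μ - ν - 1) / 4) *
    ((x ^ 2 + y ^ 2 + 2 * t : ℝ) : ℂ) ^ ((1 + ν + μ) / 4) *
    legendreP ((μ - ν - 1) / 2) ((1 + ν + μ) / 2)
      (x * y / Real.sqrt ((x ^ 2 + 2 * t) * (y ^ 2 + 2 * t)))

/-!
The parabolic cylinder functions are written as Laplace integrals, their product is the Laplace
integral of a convolution, and the convolution is a Legendre function.

Laplace integrals. Expanding `exp (-x u)` in `W(s) = ∫₀^∞ exp (-x u - u² / 2) u ^ (s - 1) du`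
gives Kummer's two series, hence `D_ν(x) = exp (-x² / 4) W(-ν) / Γ(-ν)` for `Re ν < 0`; after an
integration by parts the representation extends to `Re ν < 1`
(`parabolicCylinderD_eq_weberIntegral_combination`). The subordination identities write
`exp (-x u)` as a mixture of the Gaussians `exp (-x² u² / (4 τ))`, either with density
`τ ^ (-1 / 2) exp (-τ)` or with density proportional to `τ ^ (-3 / 2) exp (-τ)`. Fubini's theorem
and the Mellin transform of a Gaussian then yield
`D_ν(x) ∝ exp (-x² / 4) x ∫ exp (-τ) (2 τ) ^ (-ν / 2 - 1) (x² + 2 τ) ^ ((ν - 1) / 2) dτ` and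
`D_μ(y) ∝ exp (-y² / 4) ∫ exp (-τ) (2 τ) ^ (-(1 + μ) / 2) (y² + 2 τ) ^ (μ / 2) dτ`,
the first for `Re ν < 0` and `x > 0`, the second for `Re μ < 1` and `y ≥ 0`. Using a different
representation for each factor is what makes the rest work.

The convolution. At `t` it is an integral of four powers of linear functions over `(0, t)`, with
exponents adding up to `-2`. A Möbius substitution therefore reduces it to the Euler integral
`∫₀¹ v ^ (-ν / 2 - 1) (1 - v) ^ ((1 - μ) / 2 - 1) (1 - w v) ^ (μ / 2) dv`, where `w = 1 - s²` and
`s = x y / √((x² + 2 t) (y² + 2 t))` is the argument of the Legendre function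
(`integral_laplaceDensity_mul`).

The Legendre function. Euler's integral is a multiple of `F(-μ / 2, -ν / 2; (1 - ν - μ) / 2; w)`.
With `z = (1 - s) / 2` one has `w = 4 z (1 - z)`, and the quadratic transformation
`(1 - z) ^ (α + β - 1 / 2) F(α, β; α + β + 1 / 2; 4 z (1 - z)) =
F(1 / 2 + β - α, 1 / 2 + α - β; α + β + 1 / 2; z)` leads to the series that defines the Legendre
function. It holds near `z = 0` because both sides are analytic solutions of the same
hypergeometric equation with the same value at the regular singular point `0`
(`eventually_eq_zero_of_hypergeometric_ode`), and extends to `0 ≤ z < 1 / 2` by the identity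
theorem. The value `z = 1 / 2`, that is `s = 0`, is reached by continuity.

For `x = 0` the Legendre function does not depend on `t` and the formula reduces to the Laplace
integral of `D_μ(y)`.
-/

open Complex Filter Topology Set MeasureTheory
open scoped Nat

/-! ### The hypergeometric differential equation -/

theorem hasFPowerSeriesOnBall_regularizedGaussHGFun (a b c : ℂ) :
    HasFPowerSeriesOnBall (regularizedGaussHGFun a b c) (regularizedGaussHGFunSeries a b c) 0 1 :=
  ((regularizedGaussHGFunSeries a b c).hasFPowerSeriesOnBall
    (one_pos.trans_le (radius_regularizedGaussHGFunSeries_ge_one a b c))).mono one_pos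
    (radius_regularizedGaussHGFunSeries_ge_one a b c)

theorem mem_eball_zero_one {z : ℂ} (hz : ‖z‖ < 1) : z ∈ Metric.eball (0 : ℂ) 1 := by
  rw [Metric.mem_eball, edist_zero_right, ← ofReal_norm]
  exact ENNReal.ofReal_lt_one.2 hz

theorem analyticAt_regularizedGaussHGFun (a b c : ℂ) {z : ℂ} (hz : ‖z‖ < 1) :
    AnalyticAt ℂ (regularizedGaussHGFun a b c) z :=
  (hasFPowerSeriesOnBall_regularizedGaussHGFun a b c).analyticAt_of_mem (mem_eball_zero_one hz)

theorem hasSum_coeff_of_hasFPowerSeriesOnBall {f : ℂ → ℂ} {p : FormalMultilinearSeries ℂ ℂ ℂ}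
    (hf : HasFPowerSeriesOnBall f p 0 1) {z : ℂ} (hz : ‖z‖ < 1) :
    HasSum (fun n : ℕ => p.coeff n * z ^ n) (f z) := by
  have h := hf.hasSum (y := z) (mem_eball_zero_one hz)
  simpa [FormalMultilinearSeries.apply_eq_pow_smul_coeff, mul_comm] using h

theorem hasSum_coeff_deriv {f : ℂ → ℂ} {p : FormalMultilinearSeries ℂ ℂ ℂ}
    (hf : HasFPowerSeriesOnBall f p 0 1) {z : ℂ} (hz : ‖z‖ < 1) :
    HasSum (fun n : ℕ => (n + 1) * p.coeff (n + 1) * z ^ n) (deriv f z) := by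
  have h := (hf.fderiv.hasSum (y := z) (mem_eball_zero_one hz)).mapL
    (ContinuousLinearMap.apply ℂ ℂ (1 : ℂ))
  have e : ∀ n : ℕ, (ContinuousLinearMap.apply ℂ ℂ (1 : ℂ)) (p.derivSeries n fun _ => z)
      = (n + 1) * p.coeff (n + 1) * z ^ n := by
    intro n
    rw [FormalMultilinearSeries.apply_eq_pow_smul_coeff]
    simp [FormalMultilinearSeries.derivSeries_coeff_one]
    ring
  simp_rw [e] at h
  simpa using h

theorem coeff_gauss_succ (a b c : ℂ) (hc : ∀ n : ℕ, c ≠ -n) (n : ℕ) :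
    (n + 1) * (c + n) * (regularizedGaussHGFunSeries a b c).coeff (n + 1)
      = (a + n) * (b + n) * (regularizedGaussHGFunSeries a b c).coeff n := by
  have h1 : c + n ≠ 0 := fun h => hc n (eq_neg_of_add_eq_zero_left h)
  have h2 : Gamma (c + n) ≠ 0 := by
    apply Gamma_ne_zero
    intro m hm
    apply hc (n + m)
    push_cast
    linear_combination hm
  simp only [coeff_regularizedGaussHGFunSeries, ascPochhammer_succ_eval, Nat.factorial_succ]
  push_cast
  rw [← add_assoc, Gamma_add_one _ h1]
  have : (n ! : ℂ) ≠ 0 := by exact_mod_cast Nat.factorial_ne_zero n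
  have : (n + 1 : ℂ) ≠ 0 := by exact_mod_cast Nat.succ_ne_zero n
  field_simp

/-- Termwise differentiation raises all three parameters by one. -/
theorem coeff_gauss_succ' (a b c : ℂ) (n : ℕ) :
    (n + 1) * (regularizedGaussHGFunSeries a b c).coeff (n + 1)
      = a * b * (regularizedGaussHGFunSeries (a + 1) (b + 1) (c + 1)).coeff n := by
  simp only [coeff_regularizedGaussHGFunSeries, ascPochhammer_succ_left, Nat.factorial_succ]
  simp only [Polynomial.eval_mul, Polynomial.eval_X, Polynomial.eval_comp, Polynomial.eval_add,
    Polynomial.eval_one]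
  push_cast
  rw [show c + 1 + n = c + (n + 1) by ring]
  have : (n + 1 : ℂ) ≠ 0 := by exact_mod_cast Nat.succ_ne_zero n
  field_simp

theorem hasDerivAt_regularizedGaussHGFun (a b c : ℂ) {z : ℂ} (hz : ‖z‖ < 1) :
    HasDerivAt (regularizedGaussHGFun a b c)
      (a * b * regularizedGaussHGFun (a + 1) (b + 1) (c + 1) z) z := by
  have h1 := hasSum_coeff_deriv (hasFPowerSeriesOnBall_regularizedGaussHGFun a b c) hz
  have h2 := (hasSum_coeff_of_hasFPowerSeriesOnBall
    (hasFPowerSeriesOnBall_regularizedGaussHGFun (a + 1) (b + 1) (c + 1)) hz).mul_left (a * b)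
  simp_rw [coeff_gauss_succ', mul_assoc] at h1
  simp_rw [mul_assoc] at h2 ⊢
  rw [← h1.unique h2]
  exact (analyticAt_regularizedGaussHGFun a b c hz).differentiableAt.hasDerivAt

/-- The hypergeometric differential equation, with the derivatives expressed by the contiguous
functions. -/
theorem regularizedGaussHGFun_ode (a b c : ℂ) (hc : ∀ n : ℕ, c ≠ -n) {z : ℂ} (hz : ‖z‖ < 1) :
    z * (1 - z) * (a * b * ((a + 1) * (b + 1) *
        regularizedGaussHGFun (a + 1 + 1) (b + 1 + 1) (c + 1 + 1) z))
      + (c - (a + b + 1) * z) * (a * b * regularizedGaussHGFun (a + 1) (b + 1) (c + 1) z)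
      - a * b * regularizedGaussHGFun a b c z = 0 := by
  set u := (regularizedGaussHGFunSeries a b c).coeff with hu
  have h0 : HasSum (fun n : ℕ => u n * z ^ n) (regularizedGaussHGFun a b c z) :=
    hasSum_coeff_of_hasFPowerSeriesOnBall (hasFPowerSeriesOnBall_regularizedGaussHGFun a b c) hz
  have h1 : HasSum (fun n : ℕ => (n + 1) * u (n + 1) * z ^ n)
      (a * b * regularizedGaussHGFun (a + 1) (b + 1) (c + 1) z) := by
    rw [← (hasDerivAt_regularizedGaussHGFun a b c hz).deriv]
    exact hasSum_coeff_deriv (hasFPowerSeriesOnBall_regularizedGaussHGFun a b c) hz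
  have h2 : HasSum (fun n : ℕ => (n + 1) * ((n + 2) * u (n + 2)) * z ^ n)
      (a * b * ((a + 1) * (b + 1) *
        regularizedGaussHGFun (a + 1 + 1) (b + 1 + 1) (c + 1 + 1) z)) := by
    have h := (hasSum_coeff_of_hasFPowerSeriesOnBall (hasFPowerSeriesOnBall_regularizedGaussHGFun
      (a + 1 + 1) (b + 1 + 1) (c + 1 + 1)) hz).mul_left (a * b * ((a + 1) * (b + 1)))
    rw [mul_assoc (a * b)] at h
    convert! h using 2 with n
    · have e1 := coeff_gauss_succ' a b c (n + 1)
      have e2 := coeff_gauss_succ' (a + 1) (b + 1) (c + 1) n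
      push_cast at e1
      rw [← hu] at e1
      linear_combination (n + 1) * z ^ n * e1 + a * b * z ^ n * e2
  -- Multiplication by `z` shifts the coefficients.
  have s1 : HasSum (fun n : ℕ => n * u n * z ^ n)
      (z * (a * b * regularizedGaussHGFun (a + 1) (b + 1) (c + 1) z)) := by
    rw [← hasSum_nat_add_iff' 1]
    simp only [Finset.range_one, Finset.sum_singleton, Nat.cast_zero, zero_mul, sub_zero]
    convert! h1.mul_left z using 2 with n
    push_cast; ring
  have s2 : HasSum (fun n : ℕ => n * (n + 1) * u (n + 1) * z ^ n)
      (z * (a * b * ((a + 1) * (b + 1) *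
        regularizedGaussHGFun (a + 1 + 1) (b + 1 + 1) (c + 1 + 1) z))) := by
    rw [← hasSum_nat_add_iff' 1]
    simp only [Finset.range_one, Finset.sum_singleton, Nat.cast_zero, zero_mul, sub_zero]
    convert! h2.mul_left z using 2 with n
    push_cast; ring
  have s3 : HasSum (fun n : ℕ => (n - 1) * n * u n * z ^ n)
      (z * (z * (a * b * ((a + 1) * (b + 1) *
        regularizedGaussHGFun (a + 1 + 1) (b + 1 + 1) (c + 1 + 1) z)))) := by
    rw [← hasSum_nat_add_iff' 1]
    simp only [Finset.range_one, Finset.sum_singleton, Nat.cast_zero, zero_mul, sub_zero, mul_zero]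
    convert! s2.mul_left z using 2 with n
    push_cast; ring
  -- The recurrence of the coefficients says that the combined series vanishes termwise.
  have key := (((s2.sub s3).add (h1.mul_left c)).sub (s1.mul_left (a + b + 1))).sub
    (h0.mul_left (a * b))
  have hz0 : (fun n : ℕ => n * (n + 1) * u (n + 1) * z ^ n - (n - 1) * n * u n * z ^ n
      + c * ((n + 1) * u (n + 1) * z ^ n) - (a + b + 1) * (n * u n * z ^ n)
      - a * b * (u n * z ^ n)) = fun _ => 0 := by
    funext n
    linear_combination z ^ n * coeff_gauss_succ a b c hc n
  have := hz0 ▸ key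
  have := this.unique hasSum_zero
  linear_combination this

/-- An analytic solution of `z (1 - z) h'' + (c - e z) h' - k h = 0` that vanishes at the regular
singular point `0` vanishes identically: the exponent of its leading term would have to satisfy
`m (m - 1 + c) = 0`. -/
theorem eventually_eq_zero_of_hypergeometric_ode {h : ℂ → ℂ} (hh : AnalyticAt ℂ h 0)
    (h0 : h 0 = 0) {c e k : ℂ} (hc : ∀ n : ℕ, c ≠ -n)
    (ode : ∀ᶠ z in 𝓝 0, z * (1 - z) * deriv (deriv h) z + (c - e * z) * deriv h z - k * h z = 0) :
    ∀ᶠ z in 𝓝 0, h z = 0 := by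
  by_contra hne
  obtain ⟨m, g, hg, hg0, hgm⟩ := hh.exists_eventuallyEq_pow_smul_nonzero_iff.2 hne
  simp only [sub_zero, smul_eq_mul] at hgm
  obtain _ | m := m
  · have := hgm.self_of_nhds
    simp [h0] at this
    exact hg0 this.symm
  have ga : ∀ᶠ z in 𝓝 (0 : ℂ), AnalyticAt ℂ g z := hg.eventually_analyticAt
  have d1 : ∀ᶠ z in 𝓝 (0 : ℂ), deriv h z = (m + 1) * z ^ m * g z + z ^ (m + 1) * deriv g z := by
    filter_upwards [hgm.eventually_nhds, ga] with z hz hgz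
    have e : HasDerivAt (fun z => z ^ (m + 1) * g z) _ z :=
      (hasDerivAt_pow (m + 1) z).mul hgz.differentiableAt.hasDerivAt
    rw [EventuallyEq.deriv_eq hz, e.deriv]
    push_cast
    simp
  have d2 : ∀ᶠ z in 𝓝 (0 : ℂ), z * deriv (deriv h) z = (m + 1) * m * z ^ m * g z
      + 2 * (m + 1) * z ^ (m + 1) * deriv g z + z ^ (m + 2) * deriv (deriv g) z := by
    filter_upwards [d1.eventually_nhds, ga] with z hz hgz
    have e : HasDerivAt (fun z => (m + 1) * z ^ m * g z + z ^ (m + 1) * deriv g z) _ z :=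
      (((hasDerivAt_pow m z).const_mul (m + 1 : ℂ)).mul hgz.differentiableAt.hasDerivAt).add
        ((hasDerivAt_pow (m + 1) z).mul hgz.deriv.differentiableAt.hasDerivAt)
    rw [EventuallyEq.deriv_eq hz, e.deriv]
    obtain _ | m := m
    · push_cast; ring
    · push_cast
      ring
  -- After division by `z ^ m` the equation has a limit at `0`.
  have d3 : ∀ᶠ z in 𝓝[≠] (0 : ℂ), (1 - z) * ((m + 1) * m * g z
      + 2 * (m + 1) * z * deriv g z + z ^ 2 * deriv (deriv g) z)
      + (c - e * z) * ((m + 1) * g z + z * deriv g z) - k * (z * g z) = 0 := by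
    filter_upwards [d1.filter_mono nhdsWithin_le_nhds, d2.filter_mono nhdsWithin_le_nhds,
      hgm.filter_mono nhdsWithin_le_nhds, ode.filter_mono nhdsWithin_le_nhds,
      self_mem_nhdsWithin] with z h1 h2 h3 h4 h5
    have h5 : z ^ m ≠ 0 := pow_ne_zero _ h5
    apply mul_left_cancel₀ h5
    rw [h1, h3] at h4
    linear_combination h4 - (1 - z) * h2
  have lim : ContinuousAt (fun z : ℂ => (1 - z) * ((m + 1) * m * g z
      + 2 * (m + 1) * z * deriv g z + z ^ 2 * deriv (deriv g) z)
      + (c - e * z) * ((m + 1) * g z + z * deriv g z) - k * (z * g z)) 0 := by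
    have c0 := hg.continuousAt
    have c1 := hg.deriv.continuousAt
    have c2 := hg.deriv.deriv.continuousAt
    fun_prop
  have := tendsto_nhds_unique (lim.tendsto.mono_left nhdsWithin_le_nhds)
    (tendsto_const_nhds.congr' (d3.mono fun z hz => hz.symm))
  simp only [sub_zero, one_mul, mul_zero, zero_mul, add_zero, ne_eq, OfNat.ofNat_ne_zero,
    not_false_eq_true, zero_pow] at this
  have f : (m + 1 : ℂ) * (m + c) * g 0 = 0 := by linear_combination this
  have f1 : (m + 1 : ℂ) ≠ 0 := by exact_mod_cast Nat.succ_ne_zero m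
  have f2 : (m + c : ℂ) ≠ 0 := fun h => hc m (by linear_combination h)
  exact mul_ne_zero (mul_ne_zero f1 f2) hg0 f

/-! ### A quadratic transformation -/

theorem analyticAt_one_sub_cpow_mul_gauss (α β γ r : ℂ) {z : ℂ} (hz : ‖4 * z * (1 - z)‖ < 1)
    (h1 : 1 - z ∈ slitPlane) :
    AnalyticAt ℂ (fun z => (1 - z) ^ r * regularizedGaussHGFun α β γ (4 * z * (1 - z))) z := by
  refine AnalyticAt.mul ?_ ?_
  · exact AnalyticAt.cpow (by fun_prop) analyticAt_const h1
  · exact (analyticAt_regularizedGaussHGFun α β γ hz).comp_of_eq (by fun_prop) rfl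

theorem hasDerivAt_gauss_quadratic (a b c : ℂ) {z : ℂ} (hz : ‖4 * z * (1 - z)‖ < 1) :
    HasDerivAt (fun z => regularizedGaussHGFun a b c (4 * z * (1 - z)))
      (a * b * regularizedGaussHGFun (a + 1) (b + 1) (c + 1) (4 * z * (1 - z)) *
        (4 * (1 - 2 * z))) z := by
  refine HasDerivAt.comp z (hasDerivAt_regularizedGaussHGFun a b c hz) ?_
  convert! ((hasDerivAt_id z).const_mul 4).mul ((hasDerivAt_id z).const_sub 1) using 1
  simp only [id]; ring

theorem hasDerivAt_one_sub_cpow (r : ℂ) {z : ℂ} (h1 : 1 - z ∈ slitPlane) :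
    HasDerivAt (fun z : ℂ => (1 - z) ^ r) (-(r * (1 - z) ^ (r - 1))) z := by
  convert! ((hasDerivAt_id z).const_sub 1).cpow_const (c := r) h1 using 1
  simp

/-- Near the origin, `(1 - z) ^ (γ - 1) F(α, β; γ; 4 z (1 - z))` with `γ = α + β + 1 / 2` is again
a hypergeometric function, because it solves the corresponding differential equation. -/
theorem gauss_quadratic_eventually (α β : ℂ) (hc : ∀ n : ℕ, α + β + 1 / 2 ≠ -n) :
    ∀ᶠ z in 𝓝 (0 : ℂ),
      (1 - z) ^ (α + β - 1 / 2) * regularizedGaussHGFun α β (α + β + 1 / 2) (4 * z * (1 - z)) =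
        regularizedGaussHGFun (1 / 2 + β - α) (1 / 2 + α - β) (α + β + 1 / 2) z := by
  set γ := α + β + 1 / 2 with hγ
  set r := α + β - 1 / 2 with hr
  set H : ℂ → ℂ := fun z => (1 - z) ^ r * regularizedGaussHGFun α β γ (4 * z * (1 - z)) with hH
  set K : ℂ → ℂ := regularizedGaussHGFun (1 / 2 + β - α) (1 / 2 + α - β) γ with hK
  have small : ∀ᶠ z in 𝓝 (0 : ℂ), ‖4 * z * (1 - z)‖ < 1 ∧ 1 - z ∈ slitPlane ∧ ‖z‖ < 1 := by
    have t1 : ContinuousAt (fun z : ℂ => ‖4 * z * (1 - z)‖) 0 := by fun_prop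
    have t2 : ContinuousAt (fun z : ℂ => 1 - z) 0 := by fun_prop
    have t3 : ContinuousAt (fun z : ℂ => ‖z‖) 0 := by fun_prop
    refine (t1.eventually_lt_const (by simp)).and
      ((t2.eventually_mem (isOpen_slitPlane.mem_nhds (by simp))).and
      (t3.eventually_lt_const (by simp)))
  have aH : AnalyticAt ℂ H 0 :=
    analyticAt_one_sub_cpow_mul_gauss _ _ _ _ (by simp) (by simp)
  have aK : AnalyticAt ℂ K 0 := analyticAt_regularizedGaussHGFun _ _ _ (by simp)
  have dH : ∀ᶠ z in 𝓝 (0 : ℂ), HasDerivAt H (-(r * (1 - z) ^ (r - 1)) *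
      regularizedGaussHGFun α β γ (4 * z * (1 - z)) + (1 - z) ^ r *
      (α * β * regularizedGaussHGFun (α + 1) (β + 1) (γ + 1) (4 * z * (1 - z)) *
        (4 * (1 - 2 * z)))) z := by
    filter_upwards [small] with z ⟨h1, h2, _⟩
    exact (hasDerivAt_one_sub_cpow r h2).mul (hasDerivAt_gauss_quadratic α β γ h1)
  have dK : ∀ᶠ z in 𝓝 (0 : ℂ), HasDerivAt K ((1 / 2 + β - α) * (1 / 2 + α - β) *
      regularizedGaussHGFun (1 / 2 + β - α + 1) (1 / 2 + α - β + 1) (γ + 1) z) z := by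
    filter_upwards [small] with z ⟨_, _, h3⟩
    exact hasDerivAt_regularizedGaussHGFun _ _ _ h3
  have d1 : ∀ᶠ z in 𝓝 (0 : ℂ), deriv (fun z => H z - K z) z = (-(r * (1 - z) ^ (r - 1)) *
      regularizedGaussHGFun α β γ (4 * z * (1 - z)) + (1 - z) ^ r *
      (α * β * regularizedGaussHGFun (α + 1) (β + 1) (γ + 1) (4 * z * (1 - z)) *
        (4 * (1 - 2 * z)))) - ((1 / 2 + β - α) * (1 / 2 + α - β) *
      regularizedGaussHGFun (1 / 2 + β - α + 1) (1 / 2 + α - β + 1) (γ + 1) z) := by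
    filter_upwards [dH, dK] with z h1 h2
    exact (h1.sub h2).deriv
  have key := eventually_eq_zero_of_hypergeometric_ode (h := fun z => H z - K z) (c := γ) (e := 2)
    (k := (1 / 2 + β - α) * (1 / 2 + α - β)) (aH.sub aK) ?_ hc ?_
  · filter_upwards [key] with z hz
    exact sub_eq_zero.1 hz
  · have e : ∀ a b : ℂ, regularizedGaussHGFun a b γ 0 = (Gamma γ)⁻¹ := by
      intro a b
      have h := hasSum_coeff_of_hasFPowerSeriesOnBall
        (hasFPowerSeriesOnBall_regularizedGaussHGFun a b γ) (z := 0) (by simp)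
      rw [h.unique (hasSum_single 0 (by intro n hn; simp [hn]))]
      simp [coeff_regularizedGaussHGFunSeries]
    simp [hH, hK, e]
  · filter_upwards [small, d1.eventually_nhds] with z ⟨h1, h2, h3⟩ hd
    have e (s : ℂ) : (1 - z) ^ s = (1 - z) * (1 - z) ^ (s - 1) := by
      rw [cpow_sub s _ (slitPlane_ne_zero h2), cpow_one]
      field_simp [slitPlane_ne_zero h2]
    have e1 := e (r - 1)
    have e0 : (1 - z) ^ r = (1 - z) ^ 2 * (1 - z) ^ (r - 1 - 1) := by
      rw [e r, e1]; ring
    have w' : HasDerivAt (fun z : ℂ => 4 * (1 - 2 * z)) (-8) z := by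
      convert! (((hasDerivAt_id z).const_mul 2).const_sub 1).const_mul 4 using 1
      norm_num
    have dd := ((((hasDerivAt_one_sub_cpow (r - 1) h2).const_mul r).neg.mul
      (hasDerivAt_gauss_quadratic α β γ h1)).add ((hasDerivAt_one_sub_cpow r h2).mul
      (((hasDerivAt_gauss_quadratic (α + 1) (β + 1) (γ + 1) h1).const_mul (α * β)).mul w'))).sub
      ((hasDerivAt_regularizedGaussHGFun (1 / 2 + β - α + 1) (1 / 2 + α - β + 1) (γ + 1)
        h3).const_mul ((1 / 2 + β - α) * (1 / 2 + α - β)))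
    have hd2 := (EventuallyEq.deriv_eq hd).trans dd.deriv
    rw [hd2, hd.self_of_nhds]
    have o1 := regularizedGaussHGFun_ode α β γ hc h1
    have o2 := regularizedGaussHGFun_ode (1 / 2 + β - α) (1 / 2 + α - β) γ hc h3
    simp only [hH, hK, Pi.mul_apply, Pi.neg_apply]
    rw [e0, e1]
    clear_value γ r
    subst hr hγ
    linear_combination 4 * (1 - z) ^ 2 * (1 - z) ^ (α + β - 1 / 2 - 1 - 1) * o1 - o2

/-- The quadratic transformation of `gauss_quadratic_eventually`, continued along the real segment
on which `4 z (1 - z) < 1`. -/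
theorem gauss_quadratic (α β : ℂ) (hc : ∀ n : ℕ, α + β + 1 / 2 ≠ -n) {x : ℝ} (h0 : 0 ≤ x)
    (h1 : x < 1 / 2) :
    ((1 - x : ℝ) : ℂ) ^ (α + β - 1 / 2) *
        regularizedGaussHGFun α β (α + β + 1 / 2) ((4 * x * (1 - x) : ℝ) : ℂ) =
      regularizedGaussHGFun (1 / 2 + β - α) (1 / 2 + α - β) (α + β + 1 / 2) (x : ℂ) := by
  have h := AnalyticOnNhd.eqOn_of_preconnected_of_eventuallyEq
    (f := fun z : ℂ => (1 - z) ^ (α + β - 1 / 2) *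
      regularizedGaussHGFun α β (α + β + 1 / 2) (4 * z * (1 - z)))
    (g := regularizedGaussHGFun (1 / 2 + β - α) (1 / 2 + α - β) (α + β + 1 / 2))
    (U := ofReal '' Ico 0 (1 / 2)) (𝕜 := ℂ) (z₀ := 0) ?_ ?_ ?_ ?_
    (gauss_quadratic_eventually α β hc) (mem_image_of_mem ofReal ⟨h0, h1⟩)
  · simpa using! h
  · rintro _ ⟨t, ⟨t0, t1⟩, rfl⟩
    refine analyticAt_one_sub_cpow_mul_gauss _ _ _ _ ?_ ?_
    · rw [show (4 * (t : ℂ) * (1 - t)) = ((4 * t * (1 - t) : ℝ) : ℂ) by push_cast; ring,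
        norm_real, Real.norm_of_nonneg (by nlinarith)]
      nlinarith
    · rw [show (1 - (t : ℂ)) = ((1 - t : ℝ) : ℂ) by push_cast; ring, ofReal_mem_slitPlane]
      linarith
  · rintro _ ⟨t, ⟨t0, t1⟩, rfl⟩
    apply analyticAt_regularizedGaussHGFun
    rw [norm_real, Real.norm_of_nonneg t0]
    linarith
  · exact isPreconnected_Ico.image _ continuous_ofReal.continuousOn
  · exact ⟨0, by norm_num, by simp⟩

/-! ### Euler's integral and the Legendre function on the cut -/

theorem hasSum_one_sub_cpow_neg (β : ℂ) {u : ℂ} (hu : ‖u‖ < 1) :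
    HasSum (fun n : ℕ => (ascPochhammer ℂ n).eval β / n ! * u ^ n) ((1 - u) ^ (-β)) := by
  have h := hasSum_coeff_of_hasFPowerSeriesOnBall
    (one_div_one_sub_cpow_hasFPowerSeriesOnBall_zero β) hu
  have e : ∀ n : ℕ, Ring.choose (β + n - 1) n = (ascPochhammer ℂ n).eval β / n ! := by
    intro n
    have := Ring.factorial_nsmul_multichoose_eq_ascPochhammer β n
    rw [Ring.choose, show β + n - 1 - n + 1 = β by ring, eq_div_iff (by
      exact_mod_cast Nat.factorial_ne_zero n), mul_comm, ← nsmul_eq_mul, this,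
      ← Polynomial.ascPochhammer_smeval_eq_eval]
  simp only [FormalMultilinearSeries.coeff_ofScalars, e, one_div] at h
  rwa [cpow_neg]

theorem Gamma_add_natCast {z : ℂ} (hz : 0 < z.re) (n : ℕ) :
    Gamma (z + n) = (ascPochhammer ℂ n).eval z * Gamma z := by
  have h := Gamma_add_nat_div_Gamma_eq (n := n) z (fun k hk => by
    rw [hk] at hz; simp at hz; linarith [Nat.cast_nonneg (α := ℝ) k])
  rw [← h, div_mul_cancel₀ _ (Gamma_ne_zero_of_re_pos hz)]

/-- Euler's integral for the Gaussian hypergeometric function, by termwise integration of the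
binomial series. -/
theorem euler_integral_gauss {α β δ : ℂ} (hα : 0 < α.re) (hδ : 0 < δ.re) {w : ℝ} (hw0 : 0 ≤ w)
    (hw1 : w < 1) :
    ∫ v in (0 : ℝ)..1, (v : ℂ) ^ (α - 1) * (1 - (v : ℂ)) ^ (δ - 1) * (1 - (w : ℂ) * v) ^ (-β) =
      Gamma α * Gamma δ * regularizedGaussHGFun β α (α + δ) w := by
  have hint := betaIntegral_convergent hα hδ
  have hnw : ‖(w : ℂ)‖ < 1 := by rwa [norm_real, Real.norm_of_nonneg hw0]
  have hsum : Summable (fun n : ℕ => ‖(ascPochhammer ℂ n).eval β / n ! * (w : ℂ) ^ n‖) :=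
    (hasSum_one_sub_cpow_neg β hnw).summable.norm
  have uI : uIoc (0 : ℝ) 1 = Ioc 0 1 := uIoc_of_le zero_le_one
  have h := intervalIntegral.hasSum_integral_of_dominated_convergence (a := 0) (b := 1)
    (μ := volume) (F := fun (n : ℕ) (v : ℝ) => (v : ℂ) ^ (α - 1) * (1 - (v : ℂ)) ^ (δ - 1) *
      ((ascPochhammer ℂ n).eval β / n ! * ((w : ℂ) * v) ^ n))
    (f := fun v : ℝ => (v : ℂ) ^ (α - 1) * (1 - (v : ℂ)) ^ (δ - 1) * (1 - (w : ℂ) * v) ^ (-β))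
    (fun n v => ‖(v : ℂ) ^ (α - 1) * (1 - (v : ℂ)) ^ (δ - 1)‖ *
      ‖(ascPochhammer ℂ n).eval β / n ! * (w : ℂ) ^ n‖) ?_ ?_ ?_ ?_ ?_
  · have e : ∀ n : ℕ, ∫ v in (0 : ℝ)..1, (v : ℂ) ^ (α - 1) * (1 - (v : ℂ)) ^ (δ - 1) *
        ((ascPochhammer ℂ n).eval β / n ! * ((w : ℂ) * v) ^ n) = Gamma α * Gamma δ *
        ((regularizedGaussHGFunSeries β α (α + δ)).coeff n * (w : ℂ) ^ n) := by
      intro n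
      have hαn : 0 < (α + n).re := by
        simp only [add_re, natCast_re]; positivity
      have hb := Gamma_mul_Gamma_eq_betaIntegral hαn hδ
      have h1 : ∫ v in (0 : ℝ)..1, (v : ℂ) ^ (α - 1) * (1 - (v : ℂ)) ^ (δ - 1) *
          ((ascPochhammer ℂ n).eval β / n ! * ((w : ℂ) * v) ^ n) =
          (ascPochhammer ℂ n).eval β / n ! * (w : ℂ) ^ n * betaIntegral (α + n) δ := by
        rw [betaIntegral, ← intervalIntegral.integral_const_mul]
        refine intervalIntegral.integral_congr_ae (Eventually.of_forall fun v hv => ?_)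
        rw [uI] at hv
        have hv0 : (v : ℂ) ≠ 0 := ofReal_ne_zero.2 hv.1.ne'
        rw [show α + n - 1 = α - 1 + n by ring, cpow_add _ _ hv0, cpow_natCast]
        ring
      have hne : Gamma (α + n + δ) ≠ 0 := Gamma_ne_zero_of_re_pos (by
        simp only [add_re, natCast_re] at hαn ⊢; linarith)
      rw [h1, coeff_regularizedGaussHGFunSeries, show α + δ + n = α + n + δ by ring]
      rw [Gamma_add_natCast hα] at hb
      rw [show betaIntegral (α + n) δ = (ascPochhammer ℂ n).eval α * Gamma α * Gamma δ /
        Gamma (α + n + δ) by rw [hb]; field_simp]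
      field_simp
    simp_rw [e] at h
    exact h.unique ((hasSum_coeff_of_hasFPowerSeriesOnBall
      (hasFPowerSeriesOnBall_regularizedGaussHGFun β α (α + δ)) hnw).mul_left _)
  · intro n
    rw [uI]
    have := hint.1.aestronglyMeasurable
    exact this.mul (by fun_prop)
  · intro n
    refine Eventually.of_forall fun v hv => ?_
    rw [uI] at hv
    rw [norm_mul]
    refine mul_le_mul_of_nonneg_left ?_ (norm_nonneg _)
    rw [mul_pow, ← mul_assoc, norm_mul]
    refine mul_le_of_le_one_right (norm_nonneg _) ?_
    rw [norm_pow, norm_real, Real.norm_of_nonneg hv.1.le]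
    exact pow_le_one₀ hv.1.le hv.2
  · exact Eventually.of_forall fun v _ => hsum.mul_left _
  · simp_rw [tsum_mul_left]
    exact hint.norm.mul_const _
  · refine Eventually.of_forall fun v hv => ?_
    rw [uI] at hv
    refine (hasSum_one_sub_cpow_neg β ?_).mul_left _
    rw [norm_mul, norm_real, norm_real, Real.norm_of_nonneg hw0, Real.norm_of_nonneg hv.1.le]
    nlinarith [hv.1, hv.2]

/-- The Euler integral converges at `w = 1` as well, and is continuous there. -/
theorem tendsto_euler_integral {α β δ : ℂ} (hα : 0 < α.re) (hδ : 0 < δ.re) (hδβ : 0 < (δ - β).re) :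
    Tendsto (fun w : ℝ => ∫ v in (0 : ℝ)..1,
        (v : ℂ) ^ (α - 1) * (1 - (v : ℂ)) ^ (δ - 1) * (1 - (w : ℂ) * v) ^ (-β)) (𝓝[<] 1)
      (𝓝 (∫ v in (0 : ℝ)..1,
        (v : ℂ) ^ (α - 1) * (1 - (v : ℂ)) ^ (δ - 1) * (1 - ((1 : ℝ) : ℂ) * v) ^ (-β))) := by
  have uI : uIoc (0 : ℝ) 1 = Ioc 0 1 := uIoc_of_le zero_le_one
  have hint := betaIntegral_convergent hα hδ
  have hint' := betaIntegral_convergent hα hδβ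
  have ne1 : ∀ᵐ v : ℝ, v ≠ 1 := by simp [ae_iff, measure_singleton]
  refine intervalIntegral.tendsto_integral_filter_of_dominated_convergence
    (fun v => ‖(v : ℂ) ^ (α - 1) * (1 - (v : ℂ)) ^ (δ - 1)‖ +
      ‖(v : ℂ) ^ (α - 1) * (1 - (v : ℂ)) ^ (δ - β - 1)‖) ?_ ?_ ?_ ?_
  · refine Eventually.of_forall fun w => ?_
    rw [uI]
    refine hint.1.aestronglyMeasurable.mul (Measurable.aestronglyMeasurable ?_)
    fun_prop
  · filter_upwards [Ioo_mem_nhdsLT zero_lt_one] with w hw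
    filter_upwards [ne1] with v hv1 hv
    rw [uI] at hv
    have hv1 : 0 < 1 - v := sub_pos.2 (lt_of_le_of_ne hv.2 hv1)
    have hwv : 1 - v ≤ 1 - w * v := by nlinarith [hv.1, hw.2]
    have hwv1 : 1 - w * v ≤ 1 := by nlinarith [hv.1, hw.1]
    have e1 : (1 - (w : ℂ) * v) = ((1 - w * v : ℝ) : ℂ) := by push_cast; ring
    have e2 : (1 - (v : ℂ)) = ((1 - v : ℝ) : ℂ) := by push_cast; ring
    rw [norm_mul]
    rcases le_or_gt 0 (-β).re with hb | hb
    · refine le_add_of_le_of_nonneg (mul_le_of_le_one_right (norm_nonneg _) ?_) (norm_nonneg _)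
      rw [e1, norm_cpow_eq_rpow_re_of_pos (by linarith)]
      exact Real.rpow_le_one (by linarith) hwv1 hb
    · refine le_add_of_nonneg_of_le (norm_nonneg _) ?_
      rw [norm_mul, norm_mul, mul_assoc]
      refine mul_le_mul_of_nonneg_left ?_ (norm_nonneg _)
      rw [e1, e2, norm_cpow_eq_rpow_re_of_pos hv1, norm_cpow_eq_rpow_re_of_pos hv1,
        norm_cpow_eq_rpow_re_of_pos (by linarith),
        show (δ - β - 1).re = (δ - 1).re + (-β).re by simp; ring, Real.rpow_add hv1]
      exact mul_le_mul_of_nonneg_left (Real.rpow_le_rpow_of_nonpos hv1 hwv hb.le) (by positivity)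
  · exact hint.norm.add hint'.norm
  · filter_upwards [ne1] with v hv1 hv
    rw [uI] at hv
    have hv1 : 0 < 1 - v := sub_pos.2 (lt_of_le_of_ne hv.2 hv1)
    refine Tendsto.mono_left (ContinuousAt.tendsto ?_) nhdsWithin_le_nhds
    refine continuousAt_const.mul (ContinuousAt.cpow (by fun_prop) continuousAt_const ?_)
    rw [show (1 - ((1 : ℝ) : ℂ) * v) = ((1 - v : ℝ) : ℂ) by push_cast; ring, ofReal_mem_slitPlane]
    exact hv1

/-- Euler's integral in the variables in which it represents the Legendre function. -/
noncomputable def legendreEulerIntegral (ν μ : ℂ) (w : ℝ) : ℂ :=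
  ∫ v in (0 : ℝ)..1, (v : ℂ) ^ (-ν / 2 - 1) * (1 - (v : ℂ)) ^ ((1 - μ) / 2 - 1) *
    (1 - (w : ℂ) * v) ^ (μ / 2)

/-- Powers of positive reals as exponentials; identities between products of powers then become
linear identities between logarithms. -/
theorem ofReal_cpow_eq_exp {r : ℝ} (hr : 0 < r) (s : ℂ) :
    (r : ℂ) ^ s = Complex.exp (s * (Real.log r : ℂ)) := by
  rw [cpow_def_of_ne_zero (ofReal_ne_zero.2 hr.ne'), ofReal_log hr.le, mul_comm]

/-- For `0 < s < 1` the argument `1 - s²` of the quadratic transformation lies inside the disc of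
convergence, so that Euler's integral applies directly. -/
theorem gauss_eq_legendreEulerIntegral_of_pos {ν μ : ℂ} (hν : ν.re < 0) (hμ : μ.re < 1) {s : ℝ}
    (h0 : 0 < s) (h1 : s < 1) :
    regularizedGaussHGFun (-((μ - ν - 1) / 2)) ((μ - ν - 1) / 2 + 1) (1 - (1 + ν + μ) / 2)
      (((1 - s) / 2 : ℝ) : ℂ) = (Gamma (-ν / 2) * Gamma ((1 - μ) / 2))⁻¹ *
        (((1 + s) / 2 : ℝ) : ℂ) ^ (-(1 + ν + μ) / 2) * legendreEulerIntegral ν μ (1 - s ^ 2) := by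
  have hα : 0 < (-ν / 2).re := by simp; linarith
  have hδ : 0 < ((1 - μ) / 2).re := by simp; linarith
  have hq := gauss_quadratic (-ν / 2) (-μ / 2) (x := (1 - s) / 2) (by
    intro n hn
    have := congrArg re hn
    simp at this
    linarith [Nat.cast_nonneg (α := ℝ) n]) (by linarith) (by linarith)
  have he := euler_integral_gauss (α := -ν / 2) (β := -μ / 2) (δ := (1 - μ) / 2) hα hδ
    (w := 1 - s ^ 2) (by nlinarith) (by nlinarith)
  have h2 := Gamma_ne_zero_of_re_pos hα
  have h3 := Gamma_ne_zero_of_re_pos hδ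
  rw [legendreEulerIntegral, show μ / 2 = -(-μ / 2) by ring, he, regularizedGaussHGFun_symm (-μ / 2) (-ν / 2)]
  rw [show 1 / 2 + -μ / 2 - -ν / 2 = -((μ - ν - 1) / 2) by ring,
    show 1 / 2 + -ν / 2 - -μ / 2 = (μ - ν - 1) / 2 + 1 by ring,
    show -ν / 2 + -μ / 2 + 1 / 2 = 1 - (1 + ν + μ) / 2 by ring,
    show -ν / 2 + -μ / 2 - 1 / 2 = -(1 + ν + μ) / 2 by ring,
    show 4 * ((1 - s) / 2) * (1 - (1 - s) / 2) = 1 - s ^ 2 by ring,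
    show 1 - (1 - s) / 2 = (1 + s) / 2 by ring] at hq
  rw [← hq, show -ν / 2 + (1 - μ) / 2 = 1 - (1 + ν + μ) / 2 by ring]
  linear_combination -(((1 + s) / 2 : ℝ) : ℂ) ^ (-(1 + ν + μ) / 2) * regularizedGaussHGFun (-ν / 2)
    (-μ / 2) (1 - (1 + ν + μ) / 2) ((1 - s ^ 2 : ℝ) : ℂ) *
    inv_mul_cancel₀ (mul_ne_zero h2 h3)

theorem gauss_eq_legendreEulerIntegral {ν μ : ℂ} (hν : ν.re < 0) (hμ : μ.re < 1) {s : ℝ}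
    (h0 : 0 ≤ s) (h1 : s < 1) :
    regularizedGaussHGFun (-((μ - ν - 1) / 2)) ((μ - ν - 1) / 2 + 1) (1 - (1 + ν + μ) / 2)
      (((1 - s) / 2 : ℝ) : ℂ) = (Gamma (-ν / 2) * Gamma ((1 - μ) / 2))⁻¹ *
        (((1 + s) / 2 : ℝ) : ℂ) ^ (-(1 + ν + μ) / 2) * legendreEulerIntegral ν μ (1 - s ^ 2) := by
  rcases h0.eq_or_lt with rfl | h0
  swap
  · exact gauss_eq_legendreEulerIntegral_of_pos hν hμ h0 h1
  -- At `s = 0` both sides are limits of their values at positive `s`.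
  have hα : 0 < (-ν / 2).re := by simp; linarith
  have hδ : 0 < ((1 - μ) / 2).re := by simp; linarith
  have hδβ : 0 < ((1 - μ) / 2 - (-μ / 2)).re := by simp; linarith
  have t1 : Tendsto (fun s : ℝ => regularizedGaussHGFun (-((μ - ν - 1) / 2))
      ((μ - ν - 1) / 2 + 1) (1 - (1 + ν + μ) / 2) (((1 - s) / 2 : ℝ) : ℂ)) (𝓝[>] 0)
      (𝓝 (regularizedGaussHGFun (-((μ - ν - 1) / 2))
      ((μ - ν - 1) / 2 + 1) (1 - (1 + ν + μ) / 2) (((1 - 0) / 2 : ℝ) : ℂ))) := by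
    refine Tendsto.mono_left (ContinuousAt.tendsto (x := (0 : ℝ)) (f := fun s : ℝ =>
      regularizedGaussHGFun (-((μ - ν - 1) / 2)) ((μ - ν - 1) / 2 + 1) (1 - (1 + ν + μ) / 2)
      (((1 - s) / 2 : ℝ) : ℂ)) ?_) nhdsWithin_le_nhds
    refine ContinuousAt.comp_of_eq (analyticAt_regularizedGaussHGFun _ _ _ ?_).continuousAt
      (by fun_prop) rfl
    rw [norm_real]
    norm_num
  have t2 : Tendsto (fun s : ℝ => (((1 + s) / 2 : ℝ) : ℂ) ^ (-(1 + ν + μ) / 2)) (𝓝[>] 0)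
      (𝓝 ((((1 + 0) / 2 : ℝ) : ℂ) ^ (-(1 + ν + μ) / 2))) := by
    refine Tendsto.mono_left (ContinuousAt.tendsto (x := (0 : ℝ)) (f := fun s : ℝ =>
      (((1 + s) / 2 : ℝ) : ℂ) ^ (-(1 + ν + μ) / 2)) ?_) nhdsWithin_le_nhds
    refine ContinuousAt.cpow (by fun_prop) continuousAt_const ?_
    rw [ofReal_mem_slitPlane]
    norm_num
  have t3 : Tendsto (fun s : ℝ => 1 - s ^ 2) (𝓝[>] 0) (𝓝[<] 1) := by
    refine tendsto_nhdsWithin_iff.2 ⟨Tendsto.mono_left (Continuous.tendsto' (by fun_prop) _ _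
      (by norm_num)) nhdsWithin_le_nhds, ?_⟩
    filter_upwards [self_mem_nhdsWithin] with s hs
    have : 0 < s := hs
    simp only [mem_Iio]
    nlinarith
  have t4 := (tendsto_euler_integral hα hδ hδβ).comp t3
  have t5 := (t2.const_mul (Gamma (-ν / 2) * Gamma ((1 - μ) / 2))⁻¹).mul t4
  refine tendsto_nhds_unique t1 ?_
  rw [legendreEulerIntegral, show (1 - (0 : ℝ) ^ 2) = 1 by norm_num,
    show μ / 2 = -(-μ / 2) by ring]
  refine t5.congr' ?_
  filter_upwards [Ioo_mem_nhdsGT zero_lt_one] with s hs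
  rw [gauss_eq_legendreEulerIntegral_of_pos hν hμ hs.1 hs.2, legendreEulerIntegral,
    show μ / 2 = -(-μ / 2) by ring, Function.comp_apply]

/-- The Legendre function of the product formula as an Euler integral. -/
theorem legendreP_eq_legendreEulerIntegral {ν μ : ℂ} (hν : ν.re < 0) (hμ : μ.re < 1) {s : ℝ}
    (h0 : 0 ≤ s) (h1 : s < 1) :
    legendreP ((μ - ν - 1) / 2) ((1 + ν + μ) / 2) s =
      2 ^ ((1 + ν + μ) / 2) * (Gamma (-ν / 2) * Gamma ((1 - μ) / 2))⁻¹ *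
        ((1 - s ^ 2 : ℝ) : ℂ) ^ (-(1 + ν + μ) / 4) * legendreEulerIntegral ν μ (1 - s ^ 2) := by
  have p1 : 0 < 1 - s := by linarith
  have p2 : 0 < 1 + s := by linarith
  rw [legendreP, gauss_eq_legendreEulerIntegral hν hμ h0 h1,
    show (2 : ℂ) = ((2 : ℝ) : ℂ) by norm_num, show 1 - s ^ 2 = (1 + s) * (1 - s) by ring,
    ofReal_cpow_eq_exp (div_pos p2 p1), ofReal_cpow_eq_exp (half_pos p2),
    ofReal_cpow_eq_exp two_pos, ofReal_cpow_eq_exp (mul_pos p2 p1), Real.log_mul p2.ne' p1.ne',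
    Real.log_div p2.ne' p1.ne', Real.log_div p2.ne' two_ne_zero]
  have e : ∀ A B C D X Y : ℂ, A * B = C * D → A * (X * B * Y) = C * X * D * Y := by
    intro A B C D X Y h; linear_combination X * Y * h
  apply e
  rw [← Complex.exp_add, ← Complex.exp_add]
  congr 1
  push_cast
  ring

/-! ### Subordination: exponentials as mixtures of Gaussians -/

/-- The fundamental theorem of calculus on `(0, ∞)` for a function that has a limit at `0⁺` but is
not continuous there. -/
theorem integral_Ioi_of_hasDerivAt_of_tendsto_nhdsGT {f f' : ℝ → ℝ} {m l : ℝ}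
    (hderiv : ∀ x ∈ Ioi (0 : ℝ), HasDerivAt f (f' x) x) (h0 : Tendsto f (𝓝[>] 0) (𝓝 m))
    (h1 : Tendsto f atTop (𝓝 l)) :
    (IntegrableOn f' (Ioi 0) → ∫ x in Ioi 0, f' x = l - m) ∧
      ((∀ x ∈ Ioi (0 : ℝ), 0 ≤ f' x) → IntegrableOn f' (Ioi 0)) := by
  have hcont : ContinuousWithinAt (Function.update f 0 m) (Ici 0) 0 := by
    rw [continuousWithinAt_update_same]
    convert! h0 using 2
    ext x; simp [lt_iff_le_and_ne, eq_comm]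
  have hd : ∀ x ∈ Ioi (0 : ℝ), HasDerivAt (Function.update f 0 m) (f' x) x := by
    intro x hx
    refine (hderiv x hx).congr_of_eventuallyEq ?_
    filter_upwards [Ioi_mem_nhds hx] with y hy
    exact Function.update_of_ne (ne_of_gt hy) _ _
  have hl : Tendsto (Function.update f 0 m) atTop (𝓝 l) := by
    refine h1.congr' ?_
    filter_upwards [Ioi_mem_atTop 0] with y hy
    exact (Function.update_of_ne (ne_of_gt hy) _ _).symm
  refine ⟨fun h => ?_, fun h => integrableOn_Ioi_deriv_of_nonneg hcont hd h hl⟩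
  rw [integral_Ioi_of_hasDerivAt_of_tendsto hcont hd h hl, Function.update_self]

/-- A primitive of the Gaussian. -/
noncomputable def gaussPrimitive (v : ℝ) : ℝ := ∫ w in (0 : ℝ)..v, Real.exp (-w ^ 2)

theorem hasDerivAt_gaussPrimitive (v : ℝ) :
    HasDerivAt gaussPrimitive (Real.exp (-v ^ 2)) v := by
  have hc : Continuous fun w : ℝ => Real.exp (-w ^ 2) := by fun_prop
  exact intervalIntegral.integral_hasDerivAt_right (hc.intervalIntegrable _ _)
    hc.aestronglyMeasurable.stronglyMeasurableAtFilter hc.continuousAt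

theorem tendsto_gaussPrimitive_atTop :
    Tendsto gaussPrimitive atTop (𝓝 (√Real.pi / 2)) := by
  have h := intervalIntegral_tendsto_integral_Ioi (a := 0) (μ := volume)
    (integrable_exp_neg_mul_sq one_pos).integrableOn tendsto_id
  rw [integral_gaussian_Ioi] at h
  simpa [gaussPrimitive] using! h

theorem tendsto_gaussPrimitive_atBot :
    Tendsto gaussPrimitive atBot (𝓝 (-(√Real.pi / 2))) := by
  have h : gaussPrimitive = fun v => -gaussPrimitive (-v) := by
    ext v
    have := intervalIntegral.integral_comp_neg (a := 0) (b := -v)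
      (fun w : ℝ => Real.exp (-w ^ 2))
    simp only [neg_sq, neg_neg, neg_zero] at this
    rw [gaussPrimitive, gaussPrimitive, this, intervalIntegral.integral_symm]
  rw [h]
  exact (tendsto_gaussPrimitive_atTop.comp tendsto_neg_atBot_atTop).neg

theorem hasDerivAt_sqrt_add_div_sqrt (b : ℝ) {τ : ℝ} (hτ : 0 < τ) :
    HasDerivAt (fun τ : ℝ => √τ + b / √τ) (((√τ)⁻¹ - b * (τ * √τ)⁻¹) / 2) τ := by
  have hs : 0 < √τ := Real.sqrt_pos.2 hτ
  convert! (Real.hasDerivAt_sqrt hτ.ne').add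
    ((hasDerivAt_const τ b).div (Real.hasDerivAt_sqrt hτ.ne') hs.ne') using 1
  rw [Real.sq_sqrt hτ.le]
  field_simp
  ring

theorem tendsto_div_sqrt_nhdsGT {b : ℝ} (hb : 0 < b) :
    Tendsto (fun τ : ℝ => b / √τ) (𝓝[>] 0) atTop := by
  have h : Tendsto (fun τ : ℝ => √τ) (𝓝[>] 0) (𝓝[>] 0) := by
    refine tendsto_nhdsWithin_iff.2 ⟨Tendsto.mono_left
      (Real.continuous_sqrt.tendsto' _ _ Real.sqrt_zero) nhdsWithin_le_nhds, ?_⟩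
    filter_upwards [self_mem_nhdsWithin] with τ hτ using Real.sqrt_pos.2 hτ
  simpa [div_eq_mul_inv] using! (tendsto_inv_nhdsGT_zero.comp h).const_mul_atTop hb

theorem tendsto_sqrt_nhdsGT : Tendsto (fun τ : ℝ => √τ) (𝓝[>] 0) (𝓝 0) :=
  Tendsto.mono_left (Real.continuous_sqrt.tendsto' _ _ Real.sqrt_zero) nhdsWithin_le_nhds

theorem tendsto_sqrt_add_div_sqrt_atTop (b : ℝ) :
    Tendsto (fun τ : ℝ => √τ + b / √τ) atTop atTop :=
  Real.tendsto_sqrt_atTop.atTop_add (Real.tendsto_sqrt_atTop.const_div_atTop b)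

/-- The two subordination integrals. With `v = √τ ± a / √τ` the combinations
`(τ^(-1/2) ∓ a τ^(-3/2)) e^(-τ - a²/τ) dτ` become Gaussian integrals in `v`. -/
theorem subordination {a : ℝ} (ha : 0 < a) :
    (IntegrableOn (fun τ : ℝ => (√τ)⁻¹ * Real.exp (-τ - a ^ 2 / τ)) (Ioi 0) ∧
      ∫ τ in Ioi 0, (√τ)⁻¹ * Real.exp (-τ - a ^ 2 / τ) = √Real.pi * Real.exp (-2 * a)) ∧
    (IntegrableOn (fun τ : ℝ => a * (τ * √τ)⁻¹ * Real.exp (-τ - a ^ 2 / τ)) (Ioi 0) ∧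
      ∫ τ in Ioi 0, a * (τ * √τ)⁻¹ * Real.exp (-τ - a ^ 2 / τ) =
        √Real.pi * Real.exp (-2 * a)) := by
  -- `b = a` and `b = -a` give the difference and the sum of the two integrals.
  have hd : ∀ b : ℝ, b ^ 2 = a ^ 2 → ∀ τ ∈ Ioi (0 : ℝ),
      HasDerivAt (fun τ => Real.exp (2 * b) * gaussPrimitive (√τ + b / √τ))
        (((√τ)⁻¹ - b * (τ * √τ)⁻¹) / 2 * Real.exp (-τ - a ^ 2 / τ)) τ := by
    intro b hb τ hτ
    have hτ : 0 < τ := hτ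
    have hs : 0 < √τ := Real.sqrt_pos.2 hτ
    convert! ((hasDerivAt_gaussPrimitive _).comp τ (hasDerivAt_sqrt_add_div_sqrt b hτ)).const_mul
      (Real.exp (2 * b)) using 1
    rw [← mul_assoc, ← Real.exp_add, mul_comm]
    congr 2
    rw [add_sq, div_pow, Real.sq_sqrt hτ.le, hb]
    field_simp
    ring
  have hp := integral_Ioi_of_hasDerivAt_of_tendsto_nhdsGT (hd (-a) (by ring))
    (m := Real.exp (2 * -a) * -(√Real.pi / 2)) (l := Real.exp (2 * -a) * (√Real.pi / 2)) ?_ ?_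
  rotate_left
  · refine (tendsto_gaussPrimitive_atBot.comp ?_).const_mul _
    have := tendsto_sqrt_nhdsGT.add_atBot (tendsto_neg_atTop_atBot.comp (tendsto_div_sqrt_nhdsGT ha))
    refine this.congr fun τ => ?_
    simp [neg_div]
  · exact (tendsto_gaussPrimitive_atTop.comp (tendsto_sqrt_add_div_sqrt_atTop _)).const_mul _
  have hm := integral_Ioi_of_hasDerivAt_of_tendsto_nhdsGT (hd a rfl)
    (m := Real.exp (2 * a) * (√Real.pi / 2)) (l := Real.exp (2 * a) * (√Real.pi / 2)) ?_ ?_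
  rotate_left
  · refine (tendsto_gaussPrimitive_atTop.comp ?_).const_mul _
    exact tendsto_sqrt_nhdsGT.add_atTop (tendsto_div_sqrt_nhdsGT ha)
  · exact (tendsto_gaussPrimitive_atTop.comp (tendsto_sqrt_add_div_sqrt_atTop _)).const_mul _
  have ip := hp.2 fun τ hτ => by
    have : 0 < τ := hτ
    have : 0 < √τ := Real.sqrt_pos.2 hτ
    have : 0 ≤ (√τ)⁻¹ - -a * (τ * √τ)⁻¹ := by
      rw [neg_mul, sub_neg_eq_add]; positivity
    positivity
  have i1 : IntegrableOn (fun τ : ℝ => (√τ)⁻¹ * Real.exp (-τ - a ^ 2 / τ)) (Ioi 0) := by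
    refine Integrable.mono' (ip.const_mul 2) (by fun_prop) ?_
    filter_upwards [self_mem_ae_restrict measurableSet_Ioi] with τ hτ
    have : 0 < τ := hτ
    have : 0 < √τ := Real.sqrt_pos.2 hτ
    rw [Real.norm_of_nonneg (by positivity)]
    have : 0 ≤ a * (τ * √τ)⁻¹ * Real.exp (-τ - a ^ 2 / τ) := by positivity
    linarith
  have i2 : IntegrableOn (fun τ : ℝ => a * (τ * √τ)⁻¹ * Real.exp (-τ - a ^ 2 / τ)) (Ioi 0) := by
    refine ((ip.const_mul 2).sub i1).congr (Eventually.of_forall fun τ => ?_)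
    simp only [Pi.sub_apply]
    ring
  have em : ∀ b : ℝ, (fun τ : ℝ => ((√τ)⁻¹ - b * (τ * √τ)⁻¹) / 2 * Real.exp (-τ - a ^ 2 / τ)) =
      fun τ => 2⁻¹ * ((√τ)⁻¹ * Real.exp (-τ - a ^ 2 / τ)) -
        (2 * a)⁻¹ * b * (a * (τ * √τ)⁻¹ * Real.exp (-τ - a ^ 2 / τ)) := by
    intro b; ext τ; field_simp
  have im := hm.1 (by rw [em]; exact (i1.const_mul _).sub (i2.const_mul _))
  have ip := hp.1 ip
  rw [em, integral_sub (i1.const_mul _) (i2.const_mul _), integral_const_mul,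
    integral_const_mul] at im ip
  have e1 : (2 * a)⁻¹ * a = 2⁻¹ := by field_simp
  have e2 : (2 * a)⁻¹ * -a = -2⁻¹ := by field_simp
  rw [e1] at im
  rw [e2, show 2 * -a = -2 * a by ring] at ip
  exact ⟨⟨i1, by linarith⟩, ⟨i2, by linarith⟩⟩

/-! ### Mixtures of Gaussians under the Mellin transform -/

theorem integral_exp_neg_sq_mul_cpow {A : ℝ} (hA : 0 < A) {s : ℂ} (hs : 0 < s.re) :
    ∫ u in Ioi (0 : ℝ), (Real.exp (-A * u ^ 2 / 2) : ℂ) * (u : ℂ) ^ (s - 1) =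
      2 ^ (s / 2 - 1) * Gamma (s / 2) * (A : ℂ) ^ (-s / 2) := by
  have h := integral_cpow_mul_exp_neg_mul_Ioi (a := s / 2) (r := A / 2) (by simpa using hs)
    (by positivity)
  rw [← integral_comp_rpow_Ioi_of_pos two_pos] at h
  have e : ∀ u ∈ Ioi (0 : ℝ), (2 * u ^ ((2 : ℝ) - 1)) • (((u ^ (2 : ℝ) : ℝ) : ℂ) ^ (s / 2 - 1) *
      Complex.exp (-(((A / 2 : ℝ) : ℂ) * (u ^ (2 : ℝ) : ℝ)))) =
      2 * ((Real.exp (-A * u ^ 2 / 2) : ℂ) * (u : ℂ) ^ (s - 1)) := by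
    intro u hu
    have hu : 0 < u := hu
    rw [ofReal_cpow_eq_exp (by positivity), ofReal_cpow_eq_exp hu, Real.log_rpow hu,
      Real.rpow_two, show (2 : ℝ) - 1 = 1 by norm_num, Real.rpow_one]
    have : (u : ℂ) = Complex.exp (Real.log u) := by rw [← ofReal_exp, Real.exp_log hu]
    rw [real_smul, ofReal_mul, ofReal_exp, this]
    have e2 : ∀ x y z w v : ℂ, x + y + z = w + v →
        ((2 : ℝ) : ℂ) * cexp x * (cexp y * cexp z) = 2 * (cexp w * cexp v) := by
      intro x y z w v h
      rw [← Complex.exp_add, ← Complex.exp_add, mul_assoc, ← Complex.exp_add, ← add_assoc, h]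
      norm_num
    apply e2
    push_cast
    rw [this]
    ring
  rw [setIntegral_congr_fun measurableSet_Ioi e, integral_const_mul] at h
  have hA2 : (1 / ((A / 2 : ℝ) : ℂ)) ^ (s / 2) = 2 ^ (s / 2) * (A : ℂ) ^ (-s / 2) := by
    rw [show (1 / ((A / 2 : ℝ) : ℂ)) = ((2 / A : ℝ) : ℂ) by push_cast; field_simp,
      show (2 : ℂ) = ((2 : ℝ) : ℂ) by norm_num, ofReal_cpow_eq_exp (by positivity),
      ofReal_cpow_eq_exp two_pos, ofReal_cpow_eq_exp hA, Real.log_div two_ne_zero hA.ne',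
      ← Complex.exp_add]
    congr 1
    push_cast; ring
  rw [hA2] at h
  rw [cpow_sub _ _ two_ne_zero, cpow_one]
  linear_combination h / 2

/-- If `ψ` is a mixture of centred Gaussians, its Mellin transform is the corresponding mixture of
the Mellin transforms of the Gaussians, by Fubini's theorem. -/
theorem integral_gaussian_mixture {w A ψ : ℝ → ℝ} (hw : Measurable w) (hA : Measurable A)
    (hw0 : ∀ τ > 0, 0 ≤ w τ) (hA0 : ∀ τ > 0, 0 < A τ)
    (hψ : ∀ u > 0, IntegrableOn (fun τ => w τ * Real.exp (-A τ * u ^ 2 / 2)) (Ioi 0) ∧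
      ∫ τ in Ioi 0, w τ * Real.exp (-A τ * u ^ 2 / 2) = ψ u)
    {s : ℂ} (hs : 0 < s.re) (hint : IntegrableOn (fun u => ψ u * u ^ (s.re - 1)) (Ioi 0)) :
    IntegrableOn (fun τ => (w τ : ℂ) * (A τ : ℂ) ^ (-s / 2)) (Ioi 0) ∧
      ∫ u in Ioi (0 : ℝ), (ψ u : ℂ) * (u : ℂ) ^ (s - 1) = 2 ^ (s / 2 - 1) * Gamma (s / 2) *
        ∫ τ in Ioi 0, (w τ : ℂ) * (A τ : ℂ) ^ (-s / 2) := by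
  set f : ℝ → ℝ → ℂ := fun u τ =>
    ((w τ * Real.exp (-A τ * u ^ 2 / 2) : ℝ) : ℂ) * (u : ℂ) ^ (s - 1) with hf
  have hI : Integrable (Function.uncurry f)
      ((volume.restrict (Ioi 0)).prod (volume.restrict (Ioi 0))) := by
    rw [integrable_prod_iff]
    · constructor
      · filter_upwards [self_mem_ae_restrict measurableSet_Ioi] with u hu
        exact (Integrable.ofReal (𝕜 := ℂ) (hψ u hu).1).mul_const ((u : ℂ) ^ (s - 1))
      · refine hint.congr ?_
        filter_upwards [self_mem_ae_restrict measurableSet_Ioi] with u hu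
        rw [← (hψ u hu).2, ← integral_mul_const]
        refine setIntegral_congr_fun measurableSet_Ioi fun τ hτ => ?_
        have := hw0 τ hτ
        simp only [Function.uncurry, hf]
        rw [norm_mul, norm_real, Real.norm_of_nonneg (by positivity),
          norm_cpow_eq_rpow_re_of_pos hu, sub_re, one_re]
    · refine Measurable.aestronglyMeasurable ?_
      simp only [hf, Function.uncurry_def]
      fun_prop
  have inner : ∀ τ ∈ Ioi (0 : ℝ), ∫ u in Ioi (0 : ℝ), f u τ =
      2 ^ (s / 2 - 1) * Gamma (s / 2) * ((w τ : ℂ) * (A τ : ℂ) ^ (-s / 2)) := by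
    intro τ hτ
    simp only [hf, ofReal_mul, mul_assoc]
    rw [integral_const_mul, integral_exp_neg_sq_mul_cpow (hA0 τ hτ) hs]
    ring
  have hne : (2 : ℂ) ^ (s / 2 - 1) * Gamma (s / 2) ≠ 0 :=
    mul_ne_zero (by simp [cpow_eq_zero_iff]) (Gamma_ne_zero_of_re_pos (by simpa using hs))
  constructor
  · have h := hI.integral_prod_right
    have h2 : IntegrableOn (fun τ => 2 ^ (s / 2 - 1) * Gamma (s / 2) *
        ((w τ : ℂ) * (A τ : ℂ) ^ (-s / 2))) (Ioi 0) := by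
      refine h.congr ?_
      filter_upwards [self_mem_ae_restrict measurableSet_Ioi] with τ hτ
      exact inner τ hτ
    refine (h2.const_mul (2 ^ (s / 2 - 1) * Gamma (s / 2))⁻¹).congr
      (Eventually.of_forall fun τ => ?_)
    simp only
    rw [← mul_assoc, inv_mul_cancel₀ hne, one_mul]
  · have h := integral_integral_swap hI
    rw [setIntegral_congr_fun measurableSet_Ioi inner, integral_const_mul] at h
    rw [← h]
    refine setIntegral_congr_fun measurableSet_Ioi fun u hu => ?_
    simp only [hf]
    rw [integral_mul_const, integral_complex_ofReal, (hψ u hu).2]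

/-! ### Weber's integral and the parabolic cylinder function -/

/-- Weber's integral `∫₀^∞ exp (-x u - u² / 2) u ^ (s - 1) du`. -/
noncomputable def weberIntegral (x : ℝ) (s : ℂ) : ℂ :=
  ∫ u in Ioi (0 : ℝ), (Real.exp (-x * u - u ^ 2 / 2) : ℂ) * (u : ℂ) ^ (s - 1)

theorem integrableOn_weber_real (x : ℝ) {σ : ℝ} (hσ : 0 < σ) :
    IntegrableOn (fun u => Real.exp (-x * u - u ^ 2 / 2) * u ^ (σ - 1)) (Ioi 0) := by
  refine Integrable.mono' ((integrableOn_rpow_mul_exp_neg_mul_sq (b := 1 / 4) (by norm_num)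
    (s := σ - 1) (by linarith)).const_mul (Real.exp (x ^ 2))) (by fun_prop) ?_
  filter_upwards [self_mem_ae_restrict measurableSet_Ioi] with u hu
  have hu : 0 < u := hu
  rw [Real.norm_of_nonneg (by positivity), mul_comm, mul_left_comm, ← Real.exp_add]
  refine mul_le_mul_of_nonneg_left (Real.exp_le_exp.2 ?_) (by positivity)
  nlinarith [sq_nonneg (u / 2 + x)]

theorem integrableOn_weber (x : ℝ) {s : ℂ} (hs : 0 < s.re) :
    IntegrableOn (fun u : ℝ => (Real.exp (-x * u - u ^ 2 / 2) : ℂ) * (u : ℂ) ^ (s - 1))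
      (Ioi 0) := by
  refine Integrable.mono' (integrableOn_weber_real x hs) (by fun_prop) ?_
  filter_upwards [self_mem_ae_restrict measurableSet_Ioi] with u hu
  have hu : 0 < u := hu
  rw [norm_mul, norm_real, Real.norm_of_nonneg (by positivity), norm_cpow_eq_rpow_re_of_pos hu,
    sub_re, one_re]

/-- The terms of the power series of Weber's integral in `x`. -/
noncomputable def weberTerm (x : ℝ) (s : ℂ) (n : ℕ) : ℂ :=
  (-x : ℂ) ^ n / n ! * (2 ^ ((s + n) / 2 - 1) * Gamma ((s + n) / 2))

theorem hasSum_weberTerm (x : ℝ) {s : ℂ} (hs : 0 < s.re) :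
    HasSum (weberTerm x s) (weberIntegral x s) := by
  have hexp : ∀ z : ℂ, HasSum (fun n : ℕ => z ^ n / n !) (Complex.exp z) := fun z => by
    rw [Complex.exp_eq_exp_ℂ]
    exact NormedSpace.expSeries_div_hasSum_exp z
  have hexpR : ∀ z : ℝ, HasSum (fun n : ℕ => z ^ n / n !) (Real.exp z) := fun z => by
    rw [Real.exp_eq_exp_ℝ]
    exact NormedSpace.expSeries_div_hasSum_exp z
  have h := hasSum_integral_of_dominated_convergence (μ := volume.restrict (Ioi (0 : ℝ)))
    (F := fun (n : ℕ) (u : ℝ) => (-x * u : ℂ) ^ n / n ! *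
      ((Real.exp (-1 * u ^ 2 / 2) : ℂ) * (u : ℂ) ^ (s - 1)))
    (f := fun u : ℝ => (Real.exp (-x * u - u ^ 2 / 2) : ℂ) * (u : ℂ) ^ (s - 1))
    (fun n u => (|x| * u) ^ n / n ! * (Real.exp (-1 * u ^ 2 / 2) * u ^ (s.re - 1)))
    ?_ ?_ ?_ ?_ ?_
  · rw [weberIntegral]
    convert! h using 1
    ext n
    have hsn : 0 < (s + n).re := by simp only [add_re, natCast_re]; positivity
    have hg := integral_exp_neg_sq_mul_cpow one_pos hsn
    rw [ofReal_one, one_cpow, mul_one] at hg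
    rw [weberTerm, ← hg, ← integral_const_mul]
    refine setIntegral_congr_fun measurableSet_Ioi fun u hu => ?_
    have hu0 : (u : ℂ) ≠ 0 := ofReal_ne_zero.2 (ne_of_gt hu)
    rw [show s + n - 1 = s - 1 + n by ring, cpow_add _ _ hu0, cpow_natCast, mul_pow]
    ring
  · intro n
    fun_prop
  · intro n
    filter_upwards [self_mem_ae_restrict measurableSet_Ioi] with u hu
    have hu : 0 < u := hu
    rw [norm_mul, norm_mul, norm_real, Real.norm_of_nonneg (Real.exp_pos _).le,
      norm_cpow_eq_rpow_re_of_pos hu, norm_div, norm_pow, norm_mul, norm_neg, norm_real, norm_real,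
      Complex.norm_natCast, Real.norm_eq_abs, Real.norm_of_nonneg hu.le, sub_re, one_re]
  · exact Eventually.of_forall fun u => (hexpR _).summable.mul_right _
  · refine (integrableOn_weber_real (-|x|) hs).congr (Eventually.of_forall fun u => ?_)
    simp only
    rw [tsum_mul_right, (hexpR _).tsum_eq, ← mul_assoc, ← Real.exp_add]
    ring_nf
  · refine Eventually.of_forall fun u => ?_
    convert! (hexp (-x * u)).mul_right ((Real.exp (-1 * u ^ 2 / 2) : ℂ) * (u : ℂ) ^ (s - 1))
      using 1
    rw [← mul_assoc]
    push_cast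
    rw [← Complex.exp_add]
    ring_nf

/-- The combination `x W(s + 1) + W(s + 2)` of Weber's integrals `W` comes from the integrand of
`s W(s)` by an integration by parts, but it converges already for `Re s > -1`. -/
theorem hasSum_weberIntegral_combination (x : ℝ) {s : ℂ} (hs : -1 < s.re) :
    HasSum (fun n : ℕ => weberTerm x (s + 2) n - n * weberTerm x s n)
      (x * weberIntegral x (s + 1) + weberIntegral x (s + 2)) := by
  have h1 := hasSum_weberTerm x (s := s + 1) (by simp; linarith)
  have h2 := hasSum_weberTerm x (s := s + 2) (by simp; linarith)
  have h3 : HasSum (fun n : ℕ => -(n * weberTerm x s n)) (x * weberIntegral x (s + 1)) := by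
    rw [← hasSum_nat_add_iff' 1]
    simp only [Finset.range_one, Finset.sum_singleton, Nat.cast_zero, zero_mul, neg_zero, sub_zero]
    convert! h1.mul_left (x : ℂ) using 2 with n
    have : (n + 1 : ℂ) ≠ 0 := by exact_mod_cast Nat.succ_ne_zero n
    simp only [weberTerm, Nat.factorial_succ]
    push_cast
    rw [show s + (n + 1) = s + 1 + n by ring]
    field_simp
    ring
  convert! h3.add h2 using 2
  ring

theorem weberTerm_add_two (x : ℝ) {s : ℂ} {n : ℕ} (h : s + n ≠ 0) :
    weberTerm x (s + 2) n = (s + n) * weberTerm x s n := by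
  simp only [weberTerm]
  rw [show (s + 2 + n) / 2 - 1 = ((s + n) / 2 - 1) + 1 by ring,
    show (s + 2 + n) / 2 = (s + n) / 2 + 1 by ring, Gamma_add_one _ (by simpa using h),
    cpow_add _ _ two_ne_zero, cpow_one]
  ring

theorem weberIntegral_recurrence (x : ℝ) {s : ℂ} (hs : 0 < s.re) :
    x * weberIntegral x (s + 1) + weberIntegral x (s + 2) = s * weberIntegral x s := by
  have h1 := hasSum_weberIntegral_combination x (s := s) (by linarith)
  refine h1.unique ?_
  convert! (hasSum_weberTerm x hs).mul_left s using 2 with n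
  rw [weberTerm_add_two]
  · ring
  · intro h
    have := congrArg re h
    simp at this
    linarith [Nat.cast_nonneg (α := ℝ) n]

theorem hasSum_kummer (a b z : ℂ) :
    HasSum (fun n : ℕ => (ascPochhammer ℂ n).eval a / (n ! * Gamma (b + n)) * z ^ n)
      (regularizedHGFun {a} {b} z) := by
  have hr : (regularizedHGFunSeries {a} {b}).radius = ⊤ :=
    radius_regularizedHGFunSeries_eq_top (by simp)
  have h := ((regularizedHGFunSeries {a} {b}).hasFPowerSeriesOnBall
    (by rw [hr]; exact ENNReal.coe_lt_top)).hasSum (y := z) (by rw [hr]; simp)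
  simpa [regularizedHGFun, FormalMultilinearSeries.apply_eq_pow_smul_coeff,
    regularizedHGFunCoeff, mul_comm] using! h

/-- The duplication formula at half-integers: it turns the denominators `k! Γ(1 / 2 + k)` of
Kummer's series into `(2 k)!`. -/
theorem Gamma_half_add_nat (k : ℕ) :
    (k ! : ℂ) * Gamma (1 / 2 + k) * 4 ^ k = (2 * k)! * (√Real.pi : ℝ) := by
  have h := Complex.Gamma_mul_Gamma_add_half (1 / 2 + k)
  rw [show (1 / 2 + k + 1 / 2 : ℂ) = k + 1 by ring, Gamma_nat_eq_factorial,
    show (2 * (1 / 2 + k) : ℂ) = (2 * k : ℕ) + 1 by push_cast; ring, Gamma_nat_eq_factorial,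
    show (1 - ((2 * k : ℕ) + 1) : ℂ) = -(2 * k : ℕ) by ring, cpow_neg, cpow_natCast, pow_mul] at h
  generalize Gamma (1 / 2 + k : ℂ) = g at h ⊢
  norm_num at h
  field_simp at h
  linear_combination h

/-- The duplication formula at integers: it turns the denominators `k! Γ(3 / 2 + k)` of Kummer's
series into `(2 k + 1)!`. -/
theorem Gamma_three_halves_add_nat (k : ℕ) :
    (k ! : ℂ) * Gamma (3 / 2 + k) * 4 ^ k * 2 = (2 * k + 1)! * (√Real.pi : ℝ) := by
  have h := Complex.Gamma_mul_Gamma_add_half (k + 1)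
  rw [show (k + 1 + 1 / 2 : ℂ) = 3 / 2 + k by ring, Gamma_nat_eq_factorial,
    show (2 * (k + 1) : ℂ) = (2 * k + 1 : ℕ) + 1 by push_cast; ring, Gamma_nat_eq_factorial,
    show (1 - ((2 * k + 1 : ℕ) + 1) : ℂ) = -(2 * k + 1 : ℕ) by ring, cpow_neg, cpow_natCast,
    pow_succ, pow_mul] at h
  generalize Gamma (3 / 2 + k : ℂ) = g at h ⊢
  norm_num at h
  field_simp at h
  linear_combination h

/-- The even terms of the series of Weber's integrals are those of the first Kummer function. -/
theorem weberTerm_combination_even (y : ℝ) {μ : ℂ} (hμ : μ.re < 1) (k : ℕ) :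
    weberTerm y (-μ + 2) (2 * k) - (2 * k : ℕ) * weberTerm y (-μ) (2 * k) =
      (y : ℂ) ^ (2 * k) / (2 * k)! * 2 ^ k * 2 ^ (-μ / 2) * (ascPochhammer ℂ k).eval (-μ / 2) *
        Gamma (1 - μ / 2) := by
  have hp : 0 < (1 - μ / 2).re := by simp; linarith
  have e2 : ((-y : ℂ)) ^ (2 * k) = (y : ℂ) ^ (2 * k) := (even_two_mul k).neg_pow _
  obtain _ | k := k
  · simp only [weberTerm]
    rw [show (-μ + 2 + ((2 * 0 : ℕ) : ℂ)) / 2 = 1 - μ / 2 by push_cast; ring,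
      show 1 - μ / 2 - 1 = -μ / 2 by ring]
    simp
  · rw [weberTerm_add_two]
    swap
    · intro h
      have := congrArg re h
      simp at this
      linarith [Nat.cast_nonneg (α := ℝ) k]
    simp only [weberTerm, e2]
    rw [show (-μ + ((2 * (k + 1) : ℕ) : ℂ)) / 2 = 1 - μ / 2 + k by push_cast; ring,
      Gamma_add_natCast hp, show 1 - μ / 2 + k - 1 = -μ / 2 + k by ring,
      cpow_add _ _ two_ne_zero, cpow_natCast, ascPochhammer_succ_left]
    simp only [Polynomial.eval_mul, Polynomial.eval_X, Polynomial.eval_comp, Polynomial.eval_add,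
      Polynomial.eval_one]
    rw [show -μ / 2 + 1 = 1 - μ / 2 by ring]
    push_cast
    ring

/-- The odd terms of the series of Weber's integrals are those of the second Kummer function. -/
theorem weberTerm_combination_odd (y : ℝ) {μ : ℂ} (hμ : μ.re < 1) (k : ℕ) :
    weberTerm y (-μ + 2) (2 * k + 1) - (2 * k + 1 : ℕ) * weberTerm y (-μ) (2 * k + 1) =
      μ * ((y : ℂ) ^ (2 * k + 1) / (2 * k + 1)! * 2 ^ k * 2 ^ (-(1 + μ) / 2) *
        (ascPochhammer ℂ k).eval ((1 - μ) / 2) * Gamma ((1 - μ) / 2)) := by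
  have hp : 0 < ((1 - μ) / 2).re := by simp; linarith
  have e2 : ((-y : ℂ)) ^ (2 * k + 1) = -(y : ℂ) ^ (2 * k + 1) := Odd.neg_pow ⟨k, rfl⟩ _
  rw [weberTerm_add_two]
  swap
  · intro h
    have := congrArg re h
    simp at this
    linarith [Nat.cast_nonneg (α := ℝ) k]
  simp only [weberTerm, e2]
  rw [show (-μ + ((2 * k + 1 : ℕ) : ℂ)) / 2 = (1 - μ) / 2 + k by push_cast; ring,
    Gamma_add_natCast hp, show (1 - μ) / 2 + k - 1 = -(1 + μ) / 2 + k by ring,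
    cpow_add _ _ two_ne_zero, cpow_natCast]
  ring

theorem Gamma_one_half_sq : Gamma (1 / 2) * Gamma (1 / 2) = (√Real.pi : ℝ) * (√Real.pi : ℝ) := by
  have h2 := Gamma_half_add_nat 0
  simp at h2
  rw [one_div, h2]

theorem Gamma_neg_half_mul_Gamma_three_halves :
    Gamma (-1 / 2) * Gamma (3 / 2) = -((√Real.pi : ℝ) * (√Real.pi : ℝ)) := by
  have h1 := Gamma_add_one (-1 / 2) (by norm_num)
  have h2 := Gamma_add_one (1 / 2) (by norm_num)
  rw [show (-1 / 2 + 1 : ℂ) = 1 / 2 by norm_num] at h1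
  rw [show (1 / 2 + 1 : ℂ) = 3 / 2 by norm_num] at h2
  rw [← Gamma_one_half_sq]
  linear_combination Gamma (1 / 2) * h1 + Gamma (-1 / 2) * h2

theorem ofReal_sqrt_two_eq_cpow : ((√2 : ℝ) : ℂ) = (2 : ℂ) ^ (1 / 2 : ℂ) := by
  rw [Real.sqrt_eq_rpow, ofReal_cpow (by norm_num)]; norm_num

/-- The parabolic cylinder function of order `μ`, `Re μ < 1`, through Weber's integrals. -/
theorem parabolicCylinderD_eq_weberIntegral_combination {μ : ℂ} (hμ : μ.re < 1) (y : ℝ) :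
    parabolicCylinderD μ y = Complex.exp (-((y : ℂ) ^ 2) / 4) / Gamma (1 - μ) *
      (y * weberIntegral y (1 - μ) + weberIntegral y (2 - μ)) := by
  have h := hasSum_weberIntegral_combination y (s := -μ) (by simpa using hμ)
  rw [show -μ + 1 = 1 - μ by ring, show weberIntegral y (-μ + 2) = weberIntegral y (2 - μ) by
    rw [neg_add_eq_sub]] at h
  have k1 := hasSum_kummer (-μ / 2) (1 / 2) ((y : ℂ) ^ 2 / 2)
  have k2 := hasSum_kummer ((1 - μ) / 2) (3 / 2) ((y : ℂ) ^ 2 / 2)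
  have g1 : Gamma (1 - μ) ≠ 0 := Gamma_ne_zero_of_re_pos (by simpa using hμ)
  have g2 : Gamma ((1 - μ) / 2) ≠ 0 := Gamma_ne_zero_of_re_pos (by simpa using hμ)
  have g3 : Gamma (1 - μ / 2) ≠ 0 := Gamma_ne_zero_of_re_pos (by simp; linarith)
  have dup : Gamma ((1 - μ) / 2) * Gamma (1 - μ / 2) =
      Gamma (1 - μ) * (2 ^ (μ / 2) * 2 ^ (μ / 2)) * (√Real.pi : ℝ) := by
    have := Complex.Gamma_mul_Gamma_add_half ((1 - μ) / 2)
    rw [show (1 - μ) / 2 + 1 / 2 = 1 - μ / 2 by ring, show 2 * ((1 - μ) / 2) = 1 - μ by ring,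
      show 1 - (1 - μ) = μ / 2 + μ / 2 by ring, cpow_add _ _ two_ne_zero] at this
    exact this
  have two_ne : (2 : ℂ) ^ (μ / 2) ≠ 0 := by simp [cpow_eq_zero_iff]
  have c1 : (2 : ℂ) ^ (-μ / 2) = (2 ^ (μ / 2))⁻¹ := by rw [neg_div, cpow_neg]
  have s2 : ((√2 : ℝ) : ℂ) ≠ 0 := ofReal_ne_zero.2 (by positivity)
  have c2 : (2 : ℂ) ^ (-(1 + μ) / 2) = (2 ^ (μ / 2))⁻¹ * ((√2 : ℝ) : ℂ)⁻¹ := by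
    rw [show -(1 + μ) / 2 = -(μ / 2) + -(1 / 2) by ring, cpow_add _ _ two_ne_zero, cpow_neg,
      cpow_neg, ofReal_sqrt_two_eq_cpow]
  -- Valid at `μ = 0` too, where both sides vanish because `Γ 0 = 0` in Mathlib.
  have inv : (Gamma (-μ / 2))⁻¹ = -μ / 2 * (Gamma (1 - μ / 2))⁻¹ := by
    rw [one_div_Gamma_eq_self_mul_one_div_Gamma_add_one, show -μ / 2 + 1 = 1 - μ / 2 by ring]
  have hsum : HasSum (fun n : ℕ => weberTerm y (-μ + 2) n - n * weberTerm y (-μ) n)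
      (Gamma (1 - μ) * (2 ^ (μ / 2) * ((√Real.pi : ℝ) * (√Real.pi : ℝ) / Gamma ((1 - μ) / 2) *
        regularizedHGFun {-μ / 2} {1 / 2} ((y : ℂ) ^ 2 / 2))) +
      Gamma (1 - μ) * (2 ^ (μ / 2) * (y / ((√2 : ℝ) : ℂ) *
        (-((√Real.pi : ℝ) * (√Real.pi : ℝ)) / Gamma (-μ / 2)) *
        regularizedHGFun {(1 - μ) / 2} {3 / 2} ((y : ℂ) ^ 2 / 2)))) := by
    refine HasSum.even_add_odd ?_ ?_
    · convert! (((k1.mul_left _).mul_left _).mul_left _) using 2 with k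
      rw [weberTerm_combination_even y hμ k]
      have f := Gamma_half_add_nat k
      have g4 : Gamma (1 / 2 + k) ≠ 0 := Gamma_ne_zero_of_re_pos (by
        simp only [add_re, natCast_re]; norm_num; positivity)
      have f1 : (k ! : ℂ) ≠ 0 := by exact_mod_cast Nat.factorial_ne_zero k
      have f2 : ((2 * k)! : ℂ) ≠ 0 := by exact_mod_cast Nat.factorial_ne_zero (2 * k)
      rw [c1, div_pow, ← pow_mul]
      generalize (ascPochhammer ℂ k).eval (-μ / 2) = P
      generalize Gamma (1 / 2 + k : ℂ) = G4 at *
      generalize Gamma (1 - μ / 2) = G3 at *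
      generalize Gamma ((1 - μ) / 2) = G2 at *
      rw [show (4 : ℂ) = 2 * 2 by norm_num, mul_pow] at f
      field_simp
      linear_combination (y : ℂ) ^ (2 * k) * P * (G2 * G3 * f + (2 * k)! * (√Real.pi : ℝ) * dup)
    · convert! (((k2.mul_left _).mul_left _).mul_left _) using 2 with k
      rw [weberTerm_combination_odd y hμ k, div_eq_mul_inv _ (Gamma (-μ / 2)), inv]
      have f := Gamma_three_halves_add_nat k
      have g4 : Gamma (3 / 2 + k) ≠ 0 := Gamma_ne_zero_of_re_pos (by
        simp only [add_re, natCast_re]; norm_num; positivity)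
      have f1 : (k ! : ℂ) ≠ 0 := by exact_mod_cast Nat.factorial_ne_zero k
      have f2 : ((2 * k + 1)! : ℂ) ≠ 0 := by exact_mod_cast Nat.factorial_ne_zero (2 * k + 1)
      rw [c2, div_pow, ← pow_mul]
      generalize (ascPochhammer ℂ k).eval ((1 - μ) / 2) = P
      generalize Gamma (3 / 2 + k : ℂ) = G4 at *
      generalize Gamma (1 - μ / 2) = G3 at *
      generalize Gamma ((1 - μ) / 2) = G2 at *
      rw [show (4 : ℂ) = 2 * 2 by norm_num, mul_pow] at f
      field_simp
      linear_combination μ * (y : ℂ) ^ (2 * k + 1) * P *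
        (G2 * G3 * f + (2 * k + 1)! * (√Real.pi : ℝ) * dup)
  rw [h.unique hsum, parabolicCylinderD, kummerPhi, kummerPhi]
  have e1 := Gamma_one_half_sq
  have e3 := Gamma_neg_half_mul_Gamma_three_halves
  have e4 : ∀ A B : ℂ, Complex.exp (-((y : ℂ) ^ 2) / 4) / Gamma (1 - μ) *
      (Gamma (1 - μ) * A + Gamma (1 - μ) * B) = Complex.exp (-((y : ℂ) ^ 2) / 4) * (A + B) := by
    intro A B; field_simp
  rw [e4]
  linear_combination 2 ^ (μ / 2) * Complex.exp (-((y : ℂ) ^ 2) / 4) *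
    (regularizedHGFun {-μ / 2} {1 / 2} ((y : ℂ) ^ 2 / 2) / Gamma ((1 - μ) / 2) * e1 +
      y / ((√2 : ℝ) : ℂ) / Gamma (-μ / 2) *
        regularizedHGFun {(1 - μ) / 2} {3 / 2} ((y : ℂ) ^ 2 / 2) * e3)

/-- For `Re ν < 0` the parabolic cylinder function is a single Weber integral. -/
theorem parabolicCylinderD_eq_weberIntegral {ν : ℂ} (hν : ν.re < 0) (x : ℝ) :
    parabolicCylinderD ν x = Complex.exp (-((x : ℂ) ^ 2) / 4) / Gamma (-ν) *
      weberIntegral x (-ν) := by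
  have hs : 0 < (-ν).re := by simpa using hν
  have h0 : -ν ≠ 0 := by intro h; rw [h] at hs; simp at hs
  rw [parabolicCylinderD_eq_weberIntegral_combination (by linarith)]
  have h := weberIntegral_recurrence x hs
  rw [show -ν + 1 = 1 - ν by ring, show -ν + 2 = 2 - ν by ring] at h
  have g := Gamma_add_one (-ν) h0
  rw [show -ν + 1 = 1 - ν by ring] at g
  rw [h, g]
  have := Gamma_ne_zero_of_re_pos hs
  have : ν ≠ 0 := by simpa using h0
  field_simp

/-! ### The parabolic cylinder function as a Laplace integral -/

/-- The integrand `e^(-τ) (2 τ)^p (x² + 2 τ)^q` of the Laplace integrals. -/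
noncomputable def laplaceDensity (p q : ℂ) (x τ : ℝ) : ℂ :=
  Complex.exp (-(τ : ℂ)) * ((2 * τ : ℝ) : ℂ) ^ p * ((x ^ 2 + 2 * τ : ℝ) : ℂ) ^ q

theorem exp_neg_integral_inv_sqrt :
    IntegrableOn (fun τ : ℝ => (√τ)⁻¹ * Real.exp (-τ)) (Ioi 0) ∧
      ∫ τ in Ioi 0, (√τ)⁻¹ * Real.exp (-τ) = √Real.pi := by
  have e : ∀ τ ∈ Ioi (0 : ℝ), Real.exp (-τ) * τ ^ ((1 / 2 : ℝ) - 1) = (√τ)⁻¹ * Real.exp (-τ) := by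
    intro τ hτ
    have hτ : 0 < τ := hτ
    rw [Real.sqrt_eq_rpow, ← Real.rpow_neg hτ.le, mul_comm]
    norm_num
  constructor
  · exact (Real.GammaIntegral_convergent (s := 1 / 2) (by norm_num)).congr_fun e measurableSet_Ioi
  · rw [← Real.Gamma_one_half_eq, Real.Gamma_eq_integral (by norm_num)]
    exact (setIntegral_congr_fun measurableSet_Ioi e).symm

/-- For `x > 0` and `Re ν < 0`: a Laplace integral whose exponents add up to `-3 / 2`. -/
theorem parabolicCylinderD_eq_laplace_of_pos {ν : ℂ} (hν : ν.re < 0) {x : ℝ} (hx : 0 < x) :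
    IntegrableOn (laplaceDensity (-ν / 2 - 1) ((ν - 1) / 2) x) (Ioi 0) ∧
      parabolicCylinderD ν x = Complex.exp (-((x : ℂ) ^ 2) / 4) *
        (2 ^ (ν / 2 + 1) / Gamma (-ν / 2) * x *
          ∫ τ in Ioi 0, laplaceDensity (-ν / 2 - 1) ((ν - 1) / 2) x τ) := by
  have spi : 0 < √Real.pi := Real.sqrt_pos.2 Real.pi_pos
  have hsub := integral_gaussian_mixture
    (w := fun τ => x / (2 * √Real.pi) * ((τ * √τ)⁻¹ * Real.exp (-τ)))
    (A := fun τ => 1 + x ^ 2 / (2 * τ)) (ψ := fun u => Real.exp (-x * u - u ^ 2 / 2) / u)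
    (s := 1 - ν) (by fun_prop) (by fun_prop)
    (fun τ hτ => by have := Real.sqrt_pos.2 hτ; positivity) (fun τ hτ => by positivity) ?_
    (by simp; linarith) ?_
  rotate_left
  · intro u hu
    obtain ⟨-, i, e⟩ := subordination (a := x * u / 2) (by positivity)
    have ee : (fun τ : ℝ => x / (2 * √Real.pi) * ((τ * √τ)⁻¹ * Real.exp (-τ)) *
        Real.exp (-(1 + x ^ 2 / (2 * τ)) * u ^ 2 / 2)) = fun τ =>
        Real.exp (-u ^ 2 / 2) / (u * √Real.pi) *
          (x * u / 2 * (τ * √τ)⁻¹ * Real.exp (-τ - (x * u / 2) ^ 2 / τ)) := by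
      ext τ
      have : -(1 + x ^ 2 / (2 * τ)) * u ^ 2 / 2 = -u ^ 2 / 2 + -((x * u / 2) ^ 2 / τ) := by
        field_simp; ring
      rw [this, Real.exp_add, sub_eq_add_neg, Real.exp_add]
      field_simp
    rw [ee, integral_const_mul, e]
    refine ⟨i.const_mul _, ?_⟩
    rw [show -x * u - u ^ 2 / 2 = -u ^ 2 / 2 + -2 * (x * u / 2) by ring, Real.exp_add]
    field_simp
  · refine (integrableOn_weber_real x (σ := -ν.re) (by linarith)).congr_fun ?_ measurableSet_Ioi
    intro u hu
    have hu : 0 < u := hu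
    simp only [sub_re, one_re]
    rw [Real.rpow_sub_one hu.ne', show 1 - ν.re - 1 = -ν.re by ring]
    ring
  have ew : ∀ τ ∈ Ioi (0 : ℝ), ((x / (2 * √Real.pi) * ((τ * √τ)⁻¹ * Real.exp (-τ)) : ℝ) : ℂ) *
      ((1 + x ^ 2 / (2 * τ) : ℝ) : ℂ) ^ (-(1 - ν) / 2) =
      ((x * √2 / √Real.pi : ℝ) : ℂ) * laplaceDensity (-ν / 2 - 1) ((ν - 1) / 2) x τ := by
    intro τ hτ
    have hτ : 0 < τ := hτ
    have h2 : 0 < √τ := Real.sqrt_pos.2 hτ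
    have h3 : 0 < x ^ 2 + 2 * τ := by positivity
    have h4 : 1 + x ^ 2 / (2 * τ) = (x ^ 2 + 2 * τ) / (2 * τ) := by field_simp; ring
    have h5 : x / (2 * √Real.pi) * ((τ * √τ)⁻¹ * Real.exp (-τ)) = x * √2 / √Real.pi *
        Real.exp (-τ - 3 / 2 * Real.log (2 * τ)) := by
      have h6 : (τ * √τ)⁻¹ = 2 * √2 * Real.exp (- (3 / 2 * Real.log (2 * τ))) := by
        rw [Real.log_mul two_ne_zero hτ.ne', show -(3 / 2 * (Real.log 2 + Real.log τ)) =
          -(Real.log 2) + -(Real.log τ) + (-(Real.log 2 / 2) + -(Real.log τ / 2)) by ring,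
          Real.exp_add, Real.exp_add, Real.exp_add, Real.exp_neg, Real.exp_neg, Real.exp_neg,
          Real.exp_neg, Real.exp_log two_pos, Real.exp_log hτ, ← Real.log_sqrt two_pos.le,
          ← Real.log_sqrt hτ.le, Real.exp_log h2, Real.exp_log (by positivity)]
        field_simp
      rw [h6, sub_eq_add_neg, Real.exp_add]
      field_simp
    rw [h4, h5, laplaceDensity, ofReal_cpow_eq_exp (by positivity),
      ofReal_cpow_eq_exp (by positivity), ofReal_cpow_eq_exp (by positivity),
      Real.log_div (by positivity) (by positivity), ofReal_mul, mul_assoc, ofReal_exp,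
      ← Complex.exp_add, ← Complex.exp_add, ← Complex.exp_add]
    congr 2
    push_cast
    ring
  have hc : ((x * √2 / √Real.pi : ℝ) : ℂ) ≠ 0 := ofReal_ne_zero.2 (by positivity)
  obtain ⟨hi, he⟩ := hsub
  constructor
  · have hi2 := (hi.congr_fun ew measurableSet_Ioi).const_mul ((x * √2 / √Real.pi : ℝ) : ℂ)⁻¹
    refine hi2.congr (Eventually.of_forall fun τ => ?_)
    simp only
    rw [inv_mul_cancel_left₀ hc]
  · rw [setIntegral_congr_fun measurableSet_Ioi ew, integral_const_mul] at he
    have hJ : weberIntegral x (-ν) = ∫ u in Ioi (0 : ℝ),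
        ((Real.exp (-x * u - u ^ 2 / 2) / u : ℝ) : ℂ) * (u : ℂ) ^ (1 - ν - 1) := by
      refine setIntegral_congr_fun measurableSet_Ioi fun u hu => ?_
      have hu0 : (u : ℂ) ≠ 0 := ofReal_ne_zero.2 (ne_of_gt hu)
      rw [cpow_sub _ _ hu0, cpow_one, ofReal_div, show 1 - ν - 1 = -ν by ring]
      ring
    rw [parabolicCylinderD_eq_weberIntegral hν, hJ, he]
    have hre : 0 < (-ν / 2).re := by simp; linarith
    have g1 := Gamma_ne_zero_of_re_pos hre
    have g2 : Gamma (-ν) ≠ 0 := Gamma_ne_zero_of_re_pos (by simpa using hν)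
    have dup := Complex.Gamma_mul_Gamma_add_half (-ν / 2)
    rw [show -ν / 2 + 1 / 2 = (1 - ν) / 2 by ring, show 2 * (-ν / 2) = -ν by ring] at dup
    have hp : (2 : ℂ) ^ ((1 - ν) / 2 - 1) * ((√2 : ℝ) : ℂ) * 2 ^ (1 - -ν) = 2 ^ (ν / 2 + 1) := by
      rw [ofReal_sqrt_two_eq_cpow, ← cpow_add _ _ two_ne_zero, ← cpow_add _ _ two_ne_zero]
      congr 1; ring
    rw [← hp, eq_div_of_mul_eq g1 ((mul_comm _ _).trans dup)]
    push_cast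
    field_simp

/-- For `Re μ < 1`: a Laplace integral whose exponents add up to `-1 / 2`. -/
theorem parabolicCylinderD_eq_laplace {μ : ℂ} (hμ : μ.re < 1) {y : ℝ} (hy : 0 ≤ y) :
    IntegrableOn (laplaceDensity (-(1 + μ) / 2) (μ / 2) y) (Ioi 0) ∧
      parabolicCylinderD μ y = Complex.exp (-((y : ℂ) ^ 2) / 4) *
        (2 ^ ((μ + 1) / 2) / Gamma ((1 - μ) / 2) *
          ∫ τ in Ioi 0, laplaceDensity (-(1 + μ) / 2) (μ / 2) y τ) := by
  have spi : 0 < √Real.pi := Real.sqrt_pos.2 Real.pi_pos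
  have hsub := integral_gaussian_mixture
    (w := fun τ => (√Real.pi)⁻¹ * ((√τ)⁻¹ * Real.exp (-τ) * (1 + y ^ 2 / (2 * τ))))
    (A := fun τ => 1 + y ^ 2 / (2 * τ))
    (ψ := fun u => (y + u) * Real.exp (-y * u - u ^ 2 / 2) / u)
    (s := 2 - μ) (by fun_prop) (by fun_prop)
    (fun τ hτ => by have := Real.sqrt_pos.2 hτ; positivity) (fun τ hτ => by positivity) ?_
    (by simp; linarith) ?_
  rotate_left
  · intro u hu
    -- For `y = 0` the mixture is trivial, and the formula of `subordination` degenerates.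
    rcases hy.eq_or_lt with rfl | hy
    · obtain ⟨i, e⟩ := exp_neg_integral_inv_sqrt
      have ee : (fun τ : ℝ => (√Real.pi)⁻¹ * ((√τ)⁻¹ * Real.exp (-τ) * (1 + 0 ^ 2 / (2 * τ))) *
          Real.exp (-(1 + 0 ^ 2 / (2 * τ)) * u ^ 2 / 2)) = fun τ =>
          (√Real.pi)⁻¹ * Real.exp (-u ^ 2 / 2) * ((√τ)⁻¹ * Real.exp (-τ)) := by
        ext τ
        norm_num
        ring
      rw [ee, integral_const_mul, e]
      refine ⟨i.const_mul _, ?_⟩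
      rw [show -0 * u - u ^ 2 / 2 = -u ^ 2 / 2 by ring, zero_add]
      field_simp
    · obtain ⟨⟨i1, e1⟩, i2, e2⟩ := subordination (a := y * u / 2) (by positivity)
      have ee : (fun τ : ℝ => (√Real.pi)⁻¹ * ((√τ)⁻¹ * Real.exp (-τ) * (1 + y ^ 2 / (2 * τ))) *
          Real.exp (-(1 + y ^ 2 / (2 * τ)) * u ^ 2 / 2)) = fun τ =>
          Real.exp (-u ^ 2 / 2) / √Real.pi * ((√τ)⁻¹ * Real.exp (-τ - (y * u / 2) ^ 2 / τ)) +
          Real.exp (-u ^ 2 / 2) / √Real.pi * (y / u) *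
            (y * u / 2 * (τ * √τ)⁻¹ * Real.exp (-τ - (y * u / 2) ^ 2 / τ)) := by
        ext τ
        have : -(1 + y ^ 2 / (2 * τ)) * u ^ 2 / 2 = -u ^ 2 / 2 + -((y * u / 2) ^ 2 / τ) := by
          field_simp; ring
        rw [this, Real.exp_add, sub_eq_add_neg, Real.exp_add, mul_inv]
        field_simp
      rw [ee]
      refine ⟨(i1.const_mul _).add (i2.const_mul _), ?_⟩
      rw [integral_add (i1.const_mul _) (i2.const_mul _), integral_const_mul, integral_const_mul,
        e1, e2, show -y * u - u ^ 2 / 2 = -u ^ 2 / 2 + -2 * (y * u / 2) by ring, Real.exp_add]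
      field_simp
      ring
  · refine IntegrableOn.congr_fun (Integrable.add ((integrableOn_weber_real y (σ := 1 - μ.re)
      (by linarith)).const_mul y) (integrableOn_weber_real y (σ := 2 - μ.re) (by linarith))) ?_
      measurableSet_Ioi
    intro u hu
    have hu : 0 < u := hu
    simp only [sub_re, Pi.add_apply, re_ofNat]
    rw [show 2 - μ.re - 1 = 1 - μ.re - 1 + 1 by ring, Real.rpow_add_one hu.ne']
    field_simp
  have ew : ∀ τ ∈ Ioi (0 : ℝ),
      (((√Real.pi)⁻¹ * ((√τ)⁻¹ * Real.exp (-τ) * (1 + y ^ 2 / (2 * τ))) : ℝ) : ℂ) *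
      ((1 + y ^ 2 / (2 * τ) : ℝ) : ℂ) ^ (-(2 - μ) / 2) =
      ((√2 / √Real.pi : ℝ) : ℂ) * laplaceDensity (-(1 + μ) / 2) (μ / 2) y τ := by
    intro τ hτ
    have hτ : 0 < τ := hτ
    have h2 : 0 < √τ := Real.sqrt_pos.2 hτ
    have h3 : 0 < y ^ 2 + 2 * τ := by positivity
    have h4 : 1 + y ^ 2 / (2 * τ) = (y ^ 2 + 2 * τ) / (2 * τ) := by field_simp; ring
    have h5 : (√Real.pi)⁻¹ * ((√τ)⁻¹ * Real.exp (-τ) * ((y ^ 2 + 2 * τ) / (2 * τ))) =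
        √2 / √Real.pi * Real.exp (-τ - 1 / 2 * Real.log (2 * τ) +
          (Real.log (y ^ 2 + 2 * τ) - Real.log (2 * τ))) := by
      have h6 : (√τ)⁻¹ = √2 * Real.exp (-(1 / 2 * Real.log (2 * τ))) := by
        rw [show 1 / 2 * Real.log (2 * τ) = Real.log (2 * τ) / 2 by ring,
          ← Real.log_sqrt (by positivity), Real.exp_neg, Real.exp_log (by positivity),
          Real.sqrt_mul two_pos.le]
        field_simp
      rw [h6, Real.exp_add, Real.exp_sub (Real.log _), Real.exp_log h3,
        Real.exp_log (by positivity), sub_eq_add_neg, Real.exp_add]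
      field_simp
    rw [h4, h5, laplaceDensity, ofReal_cpow_eq_exp (by positivity),
      ofReal_cpow_eq_exp (by positivity), ofReal_cpow_eq_exp (by positivity),
      Real.log_div (by positivity) (by positivity), ofReal_mul, mul_assoc, ofReal_exp,
      ← Complex.exp_add, ← Complex.exp_add, ← Complex.exp_add]
    congr 2
    push_cast
    ring
  have hc : ((√2 / √Real.pi : ℝ) : ℂ) ≠ 0 := ofReal_ne_zero.2 (by positivity)
  obtain ⟨hi, he⟩ := hsub
  constructor
  · have hi2 := (hi.congr_fun ew measurableSet_Ioi).const_mul ((√2 / √Real.pi : ℝ) : ℂ)⁻¹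
    refine hi2.congr (Eventually.of_forall fun τ => ?_)
    simp only
    rw [inv_mul_cancel_left₀ hc]
  · rw [setIntegral_congr_fun measurableSet_Ioi ew, integral_const_mul] at he
    have hJ : y * weberIntegral y (1 - μ) + weberIntegral y (2 - μ) = ∫ u in Ioi (0 : ℝ),
        (((y + u) * Real.exp (-y * u - u ^ 2 / 2) / u : ℝ) : ℂ) * (u : ℂ) ^ (2 - μ - 1) := by
      rw [weberIntegral, weberIntegral, ← integral_const_mul,
        ← integral_add ((integrableOn_weber y (by simpa using hμ)).const_mul _)
          (integrableOn_weber y (by simp; linarith))]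
      refine setIntegral_congr_fun measurableSet_Ioi fun u hu => ?_
      have hu0 : (u : ℂ) ≠ 0 := ofReal_ne_zero.2 (ne_of_gt hu)
      rw [show 2 - μ - 1 = 1 - μ - 1 + 1 by ring, cpow_add _ _ hu0, cpow_one]
      push_cast
      field_simp
    rw [parabolicCylinderD_eq_weberIntegral_combination hμ, hJ, he]
    have g1 : Gamma ((1 - μ) / 2) ≠ 0 := Gamma_ne_zero_of_re_pos (by simp; linarith)
    have g2 : Gamma (1 - μ) ≠ 0 := Gamma_ne_zero_of_re_pos (by simpa using hμ)
    have dup := Complex.Gamma_mul_Gamma_add_half ((1 - μ) / 2)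
    rw [show (1 - μ) / 2 + 1 / 2 = (2 - μ) / 2 by ring, show 2 * ((1 - μ) / 2) = 1 - μ by ring]
      at dup
    have hp : (2 : ℂ) ^ ((2 - μ) / 2 - 1) * ((√2 : ℝ) : ℂ) * 2 ^ (1 - (1 - μ)) =
        2 ^ ((μ + 1) / 2) := by
      rw [ofReal_sqrt_two_eq_cpow, ← cpow_add _ _ two_ne_zero, ← cpow_add _ _ two_ne_zero]
      congr 1; ring
    rw [← hp, eq_div_of_mul_eq g1 ((mul_comm _ _).trans dup)]
    push_cast
    field_simp

/-! ### The convolution of the two densities -/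

/-- The Möbius substitution `τ = v t x² / (x² + 2 t (1 - v))`, which maps `(0, 1)` onto `(0, t)`. -/
theorem bijOn_moebius {x t : ℝ} (hx : 0 < x) (ht : 0 < t) :
    BijOn (fun v : ℝ => v * t * x ^ 2 / (x ^ 2 + 2 * t * (1 - v))) (Ioo 0 1) (Ioo 0 t) := by
  have hx2 : 0 < x ^ 2 := by positivity
  refine InvOn.bijOn (f' := fun τ => τ * (x ^ 2 + 2 * t) / (t * (x ^ 2 + 2 * τ))) ⟨?_, ?_⟩ ?_ ?_
  · intro v hv
    have h1 : 0 < 1 - v := sub_pos.2 hv.2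
    have h2 : 0 < x ^ 2 + 2 * t * (1 - v) := by positivity
    have h3 : x ^ 2 + 2 * (v * t * x ^ 2 / (x ^ 2 + 2 * t * (1 - v))) =
        x ^ 2 * (x ^ 2 + 2 * t) / (x ^ 2 + 2 * t * (1 - v)) := by
      field_simp; ring
    have h4 : 0 < x ^ 2 + 2 * t := by positivity
    simp only
    rw [h3]
    field_simp
  · intro τ hτ
    have h0 : 0 < τ := hτ.1
    have h1 : 0 < x ^ 2 + 2 * τ := by positivity
    have h3 : x ^ 2 + 2 * t * (1 - τ * (x ^ 2 + 2 * t) / (t * (x ^ 2 + 2 * τ))) =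
        x ^ 2 * (x ^ 2 + 2 * t) / (x ^ 2 + 2 * τ) := by
      field_simp; ring
    have h4 : 0 < x ^ 2 + 2 * t := by positivity
    simp only
    rw [h3]
    field_simp
  · intro v hv
    have h1 : 0 < 1 - v := sub_pos.2 hv.2
    have h0 : 0 < v := hv.1
    refine ⟨by positivity, ?_⟩
    rw [div_lt_iff₀ (by positivity)]
    have : 0 < t * (1 - v) * (x ^ 2 + 2 * t) := by positivity
    nlinarith
  · intro τ hτ
    have h0 : 0 < τ := hτ.1
    refine ⟨by positivity, ?_⟩
    rw [div_lt_one (by positivity)]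
    nlinarith [hτ.2]

theorem hasDerivAt_moebius {x t v : ℝ} (h : x ^ 2 + 2 * t * (1 - v) ≠ 0) :
    HasDerivAt (fun v : ℝ => v * t * x ^ 2 / (x ^ 2 + 2 * t * (1 - v)))
      (t * x ^ 2 * (x ^ 2 + 2 * t) / (x ^ 2 + 2 * t * (1 - v)) ^ 2) v := by
  convert! (((hasDerivAt_id v).mul_const t).mul_const (x ^ 2)).div
    ((((hasDerivAt_id v).const_sub 1).const_mul (2 * t)).const_add (x ^ 2)) h using 1
  simp only [id]
  ring

/-- The four linear factors of the convolution integral have exponents with sum `-2`, so that a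
Möbius substitution turns it into an Euler integral whose only parameter is a cross ratio. -/
theorem integral_laplaceDensity_mul {ν μ : ℂ} {x y t : ℝ} (hx : 0 < x) (ht : 0 < t) :
    x * ∫ τ in (0 : ℝ)..t, laplaceDensity (-ν / 2 - 1) ((ν - 1) / 2) x τ *
        laplaceDensity (-(1 + μ) / 2) (μ / 2) y (t - τ) =
      1 / 2 * (Complex.exp (-(t : ℂ)) * ((2 * t : ℝ) : ℂ) ^ (-(1 + ν + μ) / 2) *
        ((x ^ 2 + 2 * t : ℝ) : ℂ) ^ (ν / 2) * ((y ^ 2 + 2 * t : ℝ) : ℂ) ^ (μ / 2) *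
        legendreEulerIntegral ν μ (2 * t * (x ^ 2 + y ^ 2 + 2 * t) /
          ((x ^ 2 + 2 * t) * (y ^ 2 + 2 * t)))) := by
  have hX : 0 < x ^ 2 + 2 * t := by positivity
  have hY : 0 < y ^ 2 + 2 * t := by positivity
  set w := 2 * t * (x ^ 2 + y ^ 2 + 2 * t) / ((x ^ 2 + 2 * t) * (y ^ 2 + 2 * t)) with hw
  have hb := bijOn_moebius hx ht
  rw [legendreEulerIntegral, intervalIntegral.integral_of_le ht.le, integral_Ioc_eq_integral_Ioo,
    intervalIntegral.integral_of_le zero_le_one, integral_Ioc_eq_integral_Ioo, ← hb.image_eq,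
    integral_image_eq_integral_abs_deriv_smul measurableSet_Ioo (fun v hv =>
      (hasDerivAt_moebius (x := x) (t := t) (v := v) (by
        have : 0 < 1 - v := sub_pos.2 hv.2
        positivity)).hasDerivWithinAt) hb.injOn, ← integral_const_mul, ← integral_const_mul,
    ← integral_const_mul]
  refine setIntegral_congr_fun measurableSet_Ioo fun v hv => ?_
  have v0 : 0 < v := hv.1
  have v1 : 0 < 1 - v := sub_pos.2 hv.2
  have hN : 0 < x ^ 2 + 2 * t * (1 - v) := by positivity
  have hw1 : w ≤ 1 := by
    rw [hw, div_le_one (by positivity)]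
    nlinarith [mul_nonneg (sq_nonneg x) (sq_nonneg y)]
  have hwv : 0 < 1 - w * v := by nlinarith
  rw [abs_of_nonneg (by positivity)]
  set N := x ^ 2 + 2 * t * (1 - v) with hNd
  have a1 : 2 * (v * t * x ^ 2 / N) = v * (2 * t) * x ^ 2 / N := by ring
  have a2 : x ^ 2 + 2 * (v * t * x ^ 2 / N) = x ^ 2 * (x ^ 2 + 2 * t) / N := by
    field_simp; rw [hNd]; ring
  have a3 : 2 * (t - v * t * x ^ 2 / N) = 2 * t * (x ^ 2 + 2 * t) * (1 - v) / N := by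
    field_simp; rw [hNd]; ring
  have a4 : y ^ 2 + 2 * (t - v * t * x ^ 2 / N) =
      (x ^ 2 + 2 * t) * (y ^ 2 + 2 * t) * (1 - w * v) / N := by
    rw [a3, hw]; field_simp; rw [hNd]; ring
  have a5 : t * x ^ 2 * (x ^ 2 + 2 * t) / N ^ 2 = 1 / 2 * Real.exp (Real.log (2 * t) +
      2 * Real.log x + Real.log (x ^ 2 + 2 * t) - 2 * Real.log N) := by
    rw [Real.exp_sub, Real.exp_add, Real.exp_add, Real.exp_log (by positivity), Real.exp_log hX,
      two_mul (Real.log x), two_mul (Real.log N), Real.exp_add, Real.exp_add, Real.exp_log hx,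
      Real.exp_log hN]
    ring
  have a6 : (x : ℂ) = Complex.exp (Real.log x) := by rw [← ofReal_exp, Real.exp_log hx]
  have b1 : (1 - (v : ℂ)) = ((1 - v : ℝ) : ℂ) := by push_cast; ring
  have b2 : (1 - (w : ℂ) * v) = ((1 - w * v : ℝ) : ℂ) := by push_cast; ring
  rw [laplaceDensity, laplaceDensity, a4, a3, a2, a1, a5, b1, b2, real_smul, ofReal_mul,
    ofReal_exp, a6]
  have lx : Real.log (x ^ 2) = 2 * Real.log x := by rw [Real.log_pow]; norm_num
  simp only [ofReal_cpow_eq_exp (show 0 < v * (2 * t) * x ^ 2 / N by positivity),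
    ofReal_cpow_eq_exp (show 0 < x ^ 2 * (x ^ 2 + 2 * t) / N by positivity),
    ofReal_cpow_eq_exp (show 0 < 2 * t * (x ^ 2 + 2 * t) * (1 - v) / N by positivity),
    ofReal_cpow_eq_exp
      (show 0 < (x ^ 2 + 2 * t) * (y ^ 2 + 2 * t) * (1 - w * v) / N by positivity),
    ofReal_cpow_eq_exp (show 0 < 2 * t by positivity), ofReal_cpow_eq_exp hX,
    ofReal_cpow_eq_exp hY, ofReal_cpow_eq_exp v0, ofReal_cpow_eq_exp v1, ofReal_cpow_eq_exp hwv]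
  have k1 : Real.log (v * (2 * t) * x ^ 2 / N) =
      Real.log v + Real.log (2 * t) + 2 * Real.log x - Real.log N := by
    rw [Real.log_div (by positivity) hN.ne', Real.log_mul (by positivity) (by positivity),
      Real.log_mul v0.ne' (by positivity), lx]
  have k2 : Real.log (x ^ 2 * (x ^ 2 + 2 * t) / N) =
      2 * Real.log x + Real.log (x ^ 2 + 2 * t) - Real.log N := by
    rw [Real.log_div (by positivity) hN.ne', Real.log_mul (by positivity) hX.ne', lx]
  have k3 : Real.log (2 * t * (x ^ 2 + 2 * t) * (1 - v) / N) =
      Real.log (2 * t) + Real.log (x ^ 2 + 2 * t) + Real.log (1 - v) - Real.log N := by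
    rw [Real.log_div (by positivity) hN.ne', Real.log_mul (by positivity) v1.ne',
      Real.log_mul (by positivity) hX.ne']
  have k4 : Real.log ((x ^ 2 + 2 * t) * (y ^ 2 + 2 * t) * (1 - w * v) / N) =
      Real.log (x ^ 2 + 2 * t) + Real.log (y ^ 2 + 2 * t) + Real.log (1 - w * v) - Real.log N := by
    rw [Real.log_div (by positivity) hN.ne', Real.log_mul (by positivity) hwv.ne',
      Real.log_mul hX.ne' hY.ne']
  rw [k1, k2, k3, k4]
  -- Compare the exponents of all the exponentials at once.
  have collect : ∀ e0 e1 e2 e3 e4 e5 e6 e7 d0 d1 d2 d3 d4 d5 d6 : ℂ,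
      e0 + (e1 + (e2 + e3 + e4 + (e5 + e6 + e7))) = d0 + d1 + d2 + d3 + (d4 + d5 + d6) →
      cexp e0 * (((1 / 2 : ℝ) : ℂ) * cexp e1 * (cexp e2 * cexp e3 * cexp e4 *
        (cexp e5 * cexp e6 * cexp e7))) =
      1 / 2 * (cexp d0 * cexp d1 * cexp d2 * cexp d3 * (cexp d4 * cexp d5 * cexp d6)) := by
    intro e0 e1 e2 e3 e4 e5 e6 e7 d0 d1 d2 d3 d4 d5 d6 h
    simp only [← Complex.exp_add, ← h]
    rw [Complex.exp_add e0, Complex.exp_add e1]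
    push_cast
    ring
  apply collect
  push_cast
  ring

/-- The integrand of the product formula after insertion of Euler's integral. -/
theorem productIntegrand_eq {ν μ : ℂ} (hν : ν.re < 0) (hμ : μ.re < 1) {x y t : ℝ} (hx : 0 ≤ x)
    (hy : 0 ≤ y) (ht : 0 < t) :
    productIntegrand ν μ x y t =
      2 ^ ((1 + ν + μ) / 2) * (Gamma (-ν / 2) * Gamma ((1 - μ) / 2))⁻¹ *
        (Complex.exp (-(t : ℂ)) * ((2 * t : ℝ) : ℂ) ^ (-(1 + ν + μ) / 2) *
        ((x ^ 2 + 2 * t : ℝ) : ℂ) ^ (ν / 2) * ((y ^ 2 + 2 * t : ℝ) : ℂ) ^ (μ / 2) *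
        legendreEulerIntegral ν μ (2 * t * (x ^ 2 + y ^ 2 + 2 * t) /
          ((x ^ 2 + 2 * t) * (y ^ 2 + 2 * t)))) := by
  have hX : 0 < x ^ 2 + 2 * t := by positivity
  have hY : 0 < y ^ 2 + 2 * t := by positivity
  have hZ : 0 < x ^ 2 + y ^ 2 + 2 * t := by positivity
  have hT : 0 < 2 * t := by positivity
  have hs : (x * y / √((x ^ 2 + 2 * t) * (y ^ 2 + 2 * t))) ^ 2 =
      x ^ 2 * y ^ 2 / ((x ^ 2 + 2 * t) * (y ^ 2 + 2 * t)) := by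
    rw [div_pow, Real.sq_sqrt (by positivity)]; ring
  have hw : 1 - (x * y / √((x ^ 2 + 2 * t) * (y ^ 2 + 2 * t))) ^ 2 =
      2 * t * (x ^ 2 + y ^ 2 + 2 * t) / ((x ^ 2 + 2 * t) * (y ^ 2 + 2 * t)) := by
    rw [hs]; field_simp; ring
  have hw0 : 0 < 2 * t * (x ^ 2 + y ^ 2 + 2 * t) / ((x ^ 2 + 2 * t) * (y ^ 2 + 2 * t)) := by
    positivity
  have hs0 : 0 ≤ x * y / √((x ^ 2 + 2 * t) * (y ^ 2 + 2 * t)) := by positivity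
  have hs1 : x * y / √((x ^ 2 + 2 * t) * (y ^ 2 + 2 * t)) < 1 := by
    nlinarith
  rw [productIntegrand, legendreP_eq_legendreEulerIntegral hν hμ hs0 hs1, hw]
  generalize legendreEulerIntegral ν μ _ = I
  generalize (2 : ℂ) ^ ((1 + ν + μ) / 2) * (Gamma (-ν / 2) * Gamma ((1 - μ) / 2))⁻¹ = C
  rw [ofReal_cpow_eq_exp hw0, ofReal_cpow_eq_exp hT, ofReal_cpow_eq_exp hT, ofReal_cpow_eq_exp hX,
    ofReal_cpow_eq_exp hX, ofReal_cpow_eq_exp hY, ofReal_cpow_eq_exp hY, ofReal_cpow_eq_exp hZ,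
    Real.log_div (by positivity) (by positivity), Real.log_mul hT.ne' hZ.ne',
    Real.log_mul hX.ne' hY.ne']
  have collect : ∀ e0 e1 e2 e3 e4 e5 d0 d1 d2 d3 : ℂ,
      e0 + e1 + e2 + e3 + e4 + e5 = d0 + d1 + d2 + d3 →
      cexp e0 * cexp e1 * cexp e2 * cexp e3 * cexp e4 * (C * cexp e5 * I) =
      C * (cexp d0 * cexp d1 * cexp d2 * cexp d3 * I) := by
    intro e0 e1 e2 e3 e4 e5 d0 d1 d2 d3 h
    simp only [← Complex.exp_add, ← h]
    rw [Complex.exp_add _ e5]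
    ring
  apply collect
  push_cast
  ring

/-! ### The product formula -/

theorem parabolicCylinderD_zero (ν : ℂ) :
    parabolicCylinderD ν 0 = 2 ^ (ν / 2) * (Gamma (1 / 2) / Gamma ((1 - ν) / 2)) := by
  have h := hasSum_kummer (-ν / 2) (1 / 2) 0
  have h0 : regularizedHGFun {-ν / 2} {1 / 2} 0 = (Gamma (1 / 2))⁻¹ := by
    rw [h.unique (hasSum_single 0 (by intro n hn; simp [hn]))]
    simp
  have g : Gamma (1 / 2) ≠ 0 := Gamma_ne_zero_of_re_pos (by norm_num)
  rw [parabolicCylinderD, kummerPhi]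
  norm_num
  norm_num at h0 g
  rw [h0, mul_inv_cancel₀ g, mul_one]

theorem legendreEulerIntegral_one {ν μ : ℂ} (hν : ν.re < 0) :
    legendreEulerIntegral ν μ 1 = Gamma (-ν / 2) * Gamma (1 / 2) / Gamma ((1 - ν) / 2) := by
  have hα : 0 < (-ν / 2).re := by simp; linarith
  have hg : Gamma ((1 - ν) / 2) ≠ 0 := Gamma_ne_zero_of_re_pos (by simp; linarith)
  have hb := Gamma_mul_Gamma_eq_betaIntegral hα (t := 1 / 2) (by norm_num)
  rw [show -ν / 2 + 1 / 2 = (1 - ν) / 2 by ring] at hb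
  rw [hb, mul_div_cancel_left₀ _ hg, legendreEulerIntegral, betaIntegral,
    intervalIntegral.integral_of_le zero_le_one, intervalIntegral.integral_of_le zero_le_one,
    integral_Ioc_eq_integral_Ioo, integral_Ioc_eq_integral_Ioo]
  refine setIntegral_congr_fun measurableSet_Ioo fun v hv => ?_
  have hv1 : (1 - (v : ℂ)) ≠ 0 := by
    rw [show (1 - (v : ℂ)) = ((1 - v : ℝ) : ℂ) by push_cast; ring]
    exact ofReal_ne_zero.2 (sub_pos.2 hv.2).ne'
  simp only [ofReal_one, one_mul]
  rw [mul_assoc, ← cpow_add _ _ hv1]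
  congr 2
  ring

/-- The convolution theorem for Laplace integrals. -/
theorem integrableOn_convolution_and_integral {f g : ℝ → ℂ} (hf : IntegrableOn f (Ioi 0))
    (hg : IntegrableOn g (Ioi 0)) :
    IntegrableOn (fun t => ∫ τ in (0 : ℝ)..t, f τ * g (t - τ)) (Ioi 0) ∧
      ∫ t in Ioi (0 : ℝ), ∫ τ in (0 : ℝ)..t, f τ * g (t - τ) =
        (∫ t in Ioi (0 : ℝ), f t) * ∫ t in Ioi (0 : ℝ), g t := by
  refine ⟨?_, integral_posConvolution hf hg (ContinuousLinearMap.mul ℝ ℂ)⟩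
  have h := integrable_posConvolution hf hg (ContinuousLinearMap.mul ℝ ℂ)
  refine h.integrableOn.congr_fun (fun t ht => ?_) measurableSet_Ioi
  simp [posConvolution, indicator_of_mem ht]

theorem mainTheorem2 (ν μ : ℂ) (hν : ν.re < 0) (hμ : μ.re < 1)
    (x y : ℝ) (hx : 0 ≤ x) (hy : 0 ≤ y) :
    MeasureTheory.IntegrableOn (fun t : ℝ => productIntegrand ν μ x y t) (Set.Ioi 0) ∧
      parabolicCylinderD ν (x : ℂ) * parabolicCylinderD μ (y : ℂ) =
        Complex.exp (-((x : ℂ) ^ 2 + (y : ℂ) ^ 2) / 4) *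
          ∫ t in Set.Ioi (0 : ℝ), productIntegrand ν μ x y t := by
  obtain ⟨iy, ey⟩ := parabolicCylinderD_eq_laplace hμ hy
  have two_pow : (2 : ℂ) ^ ((1 + ν + μ) / 2) = 2 ^ (ν / 2) * 2 ^ ((μ + 1) / 2) := by
    rw [← cpow_add _ _ two_ne_zero]; congr 1; ring
  have g1 : Gamma (-ν / 2) ≠ 0 := Gamma_ne_zero_of_re_pos (by simp; linarith)
  have g2 : Gamma ((1 - μ) / 2) ≠ 0 := Gamma_ne_zero_of_re_pos (by simp; linarith)
  have hexp : Complex.exp (-((x : ℂ) ^ 2 + (y : ℂ) ^ 2) / 4) =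
      Complex.exp (-((x : ℂ) ^ 2) / 4) * Complex.exp (-((y : ℂ) ^ 2) / 4) := by
    rw [← Complex.exp_add]; congr 1; ring
  rw [ey, hexp]
  rcases hx.eq_or_lt with rfl | hx
  · -- At `x = 0` the Legendre function is constant and no convolution is needed.
    have e : EqOn (fun t => 2 ^ (ν / 2) * 2 ^ ((μ + 1) / 2) * Gamma (1 / 2) /
        (Gamma ((1 - ν) / 2) * Gamma ((1 - μ) / 2)) * laplaceDensity (-(1 + μ) / 2) (μ / 2) y t)
        (fun t : ℝ => productIntegrand ν μ 0 y t) (Ioi 0) := by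
      intro t ht
      have ht : 0 < t := ht
      have hT : 0 < 2 * t := by positivity
      have h1 : 2 * t * ((0 : ℝ) ^ 2 + y ^ 2 + 2 * t) / ((0 ^ 2 + 2 * t) * (y ^ 2 + 2 * t)) = 1 := by
        rw [zero_pow two_ne_zero, zero_add, zero_add]
        exact div_self (by positivity)
      have h2 : ((2 * t : ℝ) : ℂ) ^ (-(1 + μ) / 2) =
          ((2 * t : ℝ) : ℂ) ^ (-(1 + ν + μ) / 2) * ((0 ^ 2 + 2 * t : ℝ) : ℂ) ^ (ν / 2) := by
        rw [zero_pow two_ne_zero, zero_add, ← cpow_add _ _ (ofReal_ne_zero.2 hT.ne')]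
        congr 1; ring
      simp only
      rw [productIntegrand_eq hν hμ le_rfl hy ht, h1, legendreEulerIntegral_one hν, laplaceDensity,
        h2, two_pow]
      generalize Gamma (-ν / 2) = G1 at g1 ⊢
      field_simp
    rw [← setIntegral_congr_fun measurableSet_Ioi e, integral_const_mul]
    refine ⟨IntegrableOn.congr_fun (iy.const_mul _) e measurableSet_Ioi, ?_⟩
    rw [ofReal_zero, parabolicCylinderD_zero]
    norm_num
    field_simp
  · obtain ⟨ix, ex⟩ := parabolicCylinderD_eq_laplace_of_pos hν hx
    obtain ⟨ic, ec⟩ := integrableOn_convolution_and_integral ix iy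
    have e : EqOn (fun t => 2 ^ (ν / 2 + 1) / Gamma (-ν / 2) * x *
        (2 ^ ((μ + 1) / 2) / Gamma ((1 - μ) / 2)) *
        ∫ τ in (0 : ℝ)..t, laplaceDensity (-ν / 2 - 1) ((ν - 1) / 2) x τ *
          laplaceDensity (-(1 + μ) / 2) (μ / 2) y (t - τ))
        (fun t : ℝ => productIntegrand ν μ x y t) (Ioi 0) := by
      intro t ht
      simp only
      rw [productIntegrand_eq hν hμ hx.le hy ht, two_pow, cpow_add _ _ two_ne_zero, cpow_one]
      have h := integral_laplaceDensity_mul (ν := ν) (μ := μ) (y := y) hx ht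
      rw [mul_inv]
      linear_combination 2 ^ (ν / 2) * 2 / Gamma (-ν / 2) *
        (2 ^ ((μ + 1) / 2) / Gamma ((1 - μ) / 2)) * h
    rw [← setIntegral_congr_fun measurableSet_Ioi e, integral_const_mul, ec, ex]
    refine ⟨IntegrableOn.congr_fun (ic.const_mul _) e measurableSet_Ioi, ?_⟩
    ring
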